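/- Let $G$ be an abelian group, and let $k$ be a commutative $G$-ring, i.e. a commutative unital ring with a homomorphism from $G$ to the group of ring automorphisms of $k$, written $\lambda\mapsto g\lambda$. Let $\delta\in k$ be arbitrary and let $n$ be an odd natural number. A $G$-Brauer $n$-diagram is a perfect matching of two columns (left and right) of $n$ nodes each, in which every edge is labelled by an element of $G$. The $G$-Brauer algebra $G\mathcal{B}_n(\delta)$ is the $k$-algebra that is free as a $k$-module on the $G$-Brauer $n$-diagrams, with the $k$-bilinear multiplication in which the product of the diagrams $x$ and $y$ is obtained by identifying the right-hand nodes of $x$ with the left-hand nodes of $y$ and forgetting the nodes in the middle; an edge formed by concatenation is labelled by the product of the labels of its parts, and every closed loop is deleted and replaced by the scalar factor $g\delta\in k$, where $g\in G$ is the product of the labels on the loop. The trivial (left or right) module $\mathbb{1}$ over $G\mathcal{B}_n(\delta)$ is the $k$-module $k$ on which a diagram acts as $1$ if it has no left-to-left and no right-to-right connections, and as $0$ otherwise. Let $\Sigma_n$ act on $G^n$ by permuting the factors, let $k[G^n\rtimes\Sigma_n]$ be the group algebra, and let $\mathbb{1}$ also denote its trivial module $k$. Then there are isomorphisms of graded $k$-modules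 $$\mathrm{Tor}_{\star}^{G\mathcal{B}_n(\delta)}(\mathbb{1},\mathbb{1})\;\cong\;\mathrm{Tor}_{\star}^{k[G^n\rtimes\Sigma_n]}(\mathbb{1},\mathbb{1})\;\cong\;H_{\star}(G^n\rtimes\Sigma_n;k),$$ where the right-hand side is group homology with coefficients in the trivial module $k$. -/

import Mathlib

universe u

/-- A perfect matching of the set `W`, given by the fixed-point-free involution that sends each
node to the node it is joined to, with each edge labelled by an element of `G`; the label of an
edge is recorded at both of its ends. -/
@[ext]
structure LabelledMatching (W : Type) (G : Type u) where
  partner : W → W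
  partner_partner : ∀ w, partner (partner w) = w
  partner_ne : ∀ w, partner w ≠ w
  label : W → G
  label_partner : ∀ w, label (partner w) = label w

namespace LabelledMatching

/-- Disjoint union of two labelled matchings. -/
def disjSum {W W' : Type} {G : Type u} (m : LabelledMatching W G) (m' : LabelledMatching W' G) :
    LabelledMatching (W ⊕ W') G where
  partner := Sum.map m.partner m'.partner
  partner_partner := by rintro (w | w) <;> simp [partner_partner]
  partner_ne := by rintro (w | w) <;> simp [partner_ne]
  label := Sum.elim m.label m'.label
  label_partner := by rintro (w | w) <;> simp [label_partner]

/-- The matching induced on `U` by an injection `f : U → W` whose image is a union of edges. -/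
noncomputable def restrict {U W : Type} {G : Type u} (m : LabelledMatching W G) (f : U → W)
    (hf : Function.Injective f) (h : ∀ u, ∃ u', f u' = m.partner (f u)) :
    LabelledMatching U G where
  partner u := (h u).choose
  partner_partner u := hf (by
    rw [(h _).choose_spec, (h u).choose_spec, m.partner_partner])
  partner_ne u e := m.partner_ne (f u) (by
    have := (h u).choose_spec
    rw [e] at this
    exact this.symm)
  label u := m.label (f u)
  label_partner u := by rw [(h u).choose_spec, m.label_partner]

/-- Identify the two nodes `a` and `b` and forget the resulting node: the edge at `a` and the edge
at `b` are joined to one edge, labelled by the product of their labels. The nodes `a` and `b`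
themselves stay in `W`, where they become the two ends of an edge of their own, with label `1`,
which plays no further role. If `a` and `b` were already joined to each other, their edge has
become a closed loop and is deleted. -/
def glue {W : Type} {G : Type u} [CommGroup G] [DecidableEq W] (m : LabelledMatching W G)
    (a b : W) (hab : a ≠ b) : LabelledMatching W G where
  partner w :=
    if w = a then b else if w = b then a
    else if w = m.partner a then m.partner b
    else if w = m.partner b then m.partner a
    else m.partner w
  label w :=
    if w = a ∨ w = b then 1
    else if w = m.partner a ∨ w = m.partner b then m.label a * m.label b
    else m.label w
  partner_partner w := by
    have h1 := m.partner_partner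
    have h2 := m.partner_ne
    grind
  partner_ne w := by
    have h1 := m.partner_partner
    have h2 := m.partner_ne
    grind
  label_partner w := by
    have h1 := m.partner_partner
    have h2 := m.partner_ne
    have h3 := m.label_partner
    grind

/-- The scalar produced when `a` and `b` are identified: a loop with label `g`, which arises if
`a` and `b` were joined by an edge labelled `g`, gives the factor `g • δ`. -/
def loopFactor {W : Type} {G k : Type u} [CommGroup G] [CommRing k] [MulSemiringAction G k]
    [DecidableEq W] (δ : k) (m : LabelledMatching W G) (a b : W) : k :=
  if m.partner a = b then m.label a • δ else 1

/-- Identify `a i` with `b i`, one after the other, for all `i` in a list. -/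
def glueList {W ι : Type} {G : Type u} [CommGroup G] [DecidableEq W] (m : LabelledMatching W G)
    (a b : ι → W) (hab : ∀ i, a i ≠ b i) : List ι → LabelledMatching W G
  | [] => m
  | i :: l => (glueList m a b hab l).glue (a i) (b i) (hab i)

/-- The product of the loop factors produced by `glueList`. -/
def loopWeight {W ι : Type} {G k : Type u} [CommGroup G] [CommRing k] [MulSemiringAction G k]
    [DecidableEq W] (δ : k) (m : LabelledMatching W G)
    (a b : ι → W) (hab : ∀ i, a i ≠ b i) : List ι → k
  | [] => 1
  | i :: l => loopWeight δ m a b hab l * (glueList m a b hab l).loopFactor δ (a i) (b i)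

section Lemmas

set_option linter.unusedSectionVars false

variable {G k : Type u} [CommGroup G] [CommRing k] [MulSemiringAction G k]
variable {U V W W' ι κ : Type} [DecidableEq U] [DecidableEq V] [DecidableEq W] [DecidableEq W']

theorem glue_comm (m : LabelledMatching W G) (a b c d : W) (hab : a ≠ b)
    (hcd : c ≠ d) (hac : a ≠ c) (had : a ≠ d) (hbc : b ≠ c) (hbd : b ≠ d) :
    (m.glue a b hab).glue c d hcd = (m.glue c d hcd).glue a b hab := by
  have h1 := m.partner_partner
  have h2 := m.partner_ne
  have h3 := m.label_partner
  ext w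
  · simp only [glue]
    grind (splits := 30)
  · simp only [glue]
    grind (splits := 30)

theorem glue_symm (m : LabelledMatching W G) (a b : W) (hab : a ≠ b) :
    m.glue a b hab = m.glue b a hab.symm := by
  have h1 := m.partner_partner
  have h2 := m.partner_ne
  ext w
  · simp only [glue]
    grind
  · simp only [glue]
    grind

theorem loopFactor_symm (δ : k) (m : LabelledMatching W G) (a b : W) :
    m.loopFactor δ a b = m.loopFactor δ b a := by
  have h1 := m.partner_partner
  have h3 := m.label_partner
  simp only [loopFactor]
  grind

theorem loopFactor_comm (δ : k) (m : LabelledMatching W G) (a b c d : W)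
    (hab : a ≠ b) (hcd : c ≠ d) (hac : a ≠ c) (had : a ≠ d) (hbc : b ≠ c) (hbd : b ≠ d) :
    m.loopFactor δ a b * (m.glue a b hab).loopFactor δ c d =
      m.loopFactor δ c d * (m.glue c d hcd).loopFactor δ a b := by
  have h1 := m.partner_partner
  have h2 := m.partner_ne
  have h3 := m.label_partner
  simp only [loopFactor, glue]
  grind (splits := 30)

/-- `m'` is the matching that `m` induces along the injection `f`. -/
def Induces (f : U → W) (m' : LabelledMatching U G) (m : LabelledMatching W G) : Prop :=
  (∀ u, m.partner (f u) = f (m'.partner u)) ∧ ∀ u, m.label (f u) = m'.label u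

theorem restrict_induces (m : LabelledMatching W G) (f : U → W)
    (hf : Function.Injective f) (h : ∀ u, ∃ u', f u' = m.partner (f u)) :
    Induces f (m.restrict f hf h) m :=
  ⟨fun u => ((h u).choose_spec).symm, fun _ => rfl⟩

theorem Induces.unique {f : U → W} (hf : Function.Injective f) {m₁ m₂ : LabelledMatching U G}
    {m : LabelledMatching W G} (h₁ : Induces f m₁ m) (h₂ : Induces f m₂ m) : m₁ = m₂ := by
  ext u
  · exact hf ((h₁.1 u).symm.trans (h₂.1 u))
  · exact (h₁.2 u).symm.trans (h₂.2 u)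

theorem Induces.comp {f : U → V} {g : V → W} {m₁ : LabelledMatching U G}
    {m₂ : LabelledMatching V G} {m₃ : LabelledMatching W G} (h : Induces f m₁ m₂)
    (h' : Induces g m₂ m₃) : Induces (g ∘ f) m₁ m₃ :=
  ⟨fun u => by simp [h'.1, h.1], fun u => by simp [h'.2, h.2]⟩

theorem Induces.glue {f : U → W} (hf : Function.Injective f) {m' : LabelledMatching U G}
    {m : LabelledMatching W G} (h : Induces f m' m) (a b : U) (hab : a ≠ b)
    (hab' : f a ≠ f b) : Induces f (m'.glue a b hab) (m.glue (f a) (f b) hab') := by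
  constructor
  · intro u
    simp only [LabelledMatching.glue, h.1, hf.eq_iff]
    split_ifs <;> rfl
  · intro u
    simp only [LabelledMatching.glue, h.1, h.2, hf.eq_iff]

theorem Induces.loopFactor {f : U → W} (hf : Function.Injective f) {m' : LabelledMatching U G}
    {m : LabelledMatching W G} (h : Induces f m' m) (δ : k) (a b : U) :
    m.loopFactor δ (f a) (f b) = m'.loopFactor δ a b := by
  simp only [LabelledMatching.loopFactor, h.1, h.2, hf.eq_iff]

theorem Induces.glueList {f : U → W} (hf : Function.Injective f) {m' : LabelledMatching U G}
    {m : LabelledMatching W G} (h : Induces f m' m) (a b : ι → U) (hab : ∀ i, a i ≠ b i)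
    (hab' : ∀ i, f (a i) ≠ f (b i)) (l : List ι) :
    Induces f (m'.glueList a b hab l)
      (m.glueList (fun i => f (a i)) (fun i => f (b i)) hab' l) := by
  induction l with
  | nil => exact h
  | cons i l ih => exact ih.glue hf _ _ _ _

theorem Induces.loopWeight {f : U → W} (hf : Function.Injective f) {m' : LabelledMatching U G}
    {m : LabelledMatching W G} (h : Induces f m' m) (δ : k) (a b : ι → U) (hab : ∀ i, a i ≠ b i)
    (hab' : ∀ i, f (a i) ≠ f (b i)) (l : List ι) :
    m.loopWeight δ (fun i => f (a i)) (fun i => f (b i)) hab' l = m'.loopWeight δ a b hab l := by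
  induction l with
  | nil => rfl
  | cons i l ih =>
    simp only [LabelledMatching.loopWeight, ih]
    rw [(h.glueList hf a b hab hab' l).loopFactor hf]

theorem glueList_glue_comm (m : LabelledMatching W G) (a b : ι → W) (hab : ∀ i, a i ≠ b i)
    (c d : W) (hcd : c ≠ d) (hac : ∀ i, a i ≠ c) (had : ∀ i, a i ≠ d) (hbc : ∀ i, b i ≠ c)
    (hbd : ∀ i, b i ≠ d) (l : List ι) :
    (m.glue c d hcd).glueList a b hab l = (m.glueList a b hab l).glue c d hcd := by
  induction l with
  | nil => rfl
  | cons i l ih =>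
    simp only [glueList, ih]
    exact (glue_comm _ _ _ _ _ _ _ (hac i) (had i) (hbc i) (hbd i)).symm

theorem loopWeight_glue_comm (δ : k) (m : LabelledMatching W G) (a b : ι → W)
    (hab : ∀ i, a i ≠ b i)
    (c d : W) (hcd : c ≠ d) (hac : ∀ i, a i ≠ c) (had : ∀ i, a i ≠ d) (hbc : ∀ i, b i ≠ c)
    (hbd : ∀ i, b i ≠ d) (l : List ι) :
    m.loopFactor δ c d * (m.glue c d hcd).loopWeight δ a b hab l =
      m.loopWeight δ a b hab l * (m.glueList a b hab l).loopFactor δ c d := by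
  induction l with
  | nil => simp [loopWeight, glueList]
  | cons i l ih =>
    simp only [loopWeight, glueList]
    rw [← mul_assoc, ih, glueList_glue_comm m a b hab c d hcd hac had hbc hbd, mul_assoc, mul_assoc,
      loopFactor_comm δ _ c d (a i) (b i) hcd (hab i) (hac i).symm (hbc i).symm (had i).symm
        (hbd i).symm]

theorem glueList_comm (m : LabelledMatching W G) (a b : ι → W) (hab : ∀ i, a i ≠ b i)
    (c d : κ → W) (hcd : ∀ i, c i ≠ d i) (hac : ∀ i j, a i ≠ c j) (had : ∀ i j, a i ≠ d j)
    (hbc : ∀ i j, b i ≠ c j) (hbd : ∀ i j, b i ≠ d j) (l : List ι) (l' : List κ) :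
    (m.glueList c d hcd l').glueList a b hab l = (m.glueList a b hab l).glueList c d hcd l' := by
  induction l' with
  | nil => rfl
  | cons j l' ih =>
    simp only [glueList]
    rw [glueList_glue_comm _ a b hab _ _ _ (fun i => hac i j) (fun i => had i j)
      (fun i => hbc i j) (fun i => hbd i j), ih]

theorem loopWeight_comm (δ : k) (m : LabelledMatching W G) (a b : ι → W) (hab : ∀ i, a i ≠ b i)
    (c d : κ → W) (hcd : ∀ i, c i ≠ d i) (hac : ∀ i j, a i ≠ c j) (had : ∀ i j, a i ≠ d j)
    (hbc : ∀ i j, b i ≠ c j) (hbd : ∀ i j, b i ≠ d j) (l : List ι) (l' : List κ) :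
    m.loopWeight δ c d hcd l' * (m.glueList c d hcd l').loopWeight δ a b hab l =
      m.loopWeight δ a b hab l * (m.glueList a b hab l).loopWeight δ c d hcd l' := by
  induction l' with
  | nil => simp [loopWeight, glueList]
  | cons j l' ih =>
    simp only [loopWeight, glueList]
    rw [mul_assoc, loopWeight_glue_comm δ _ a b hab _ _ _ (fun i => hac i j) (fun i => had i j)
      (fun i => hbc i j) (fun i => hbd i j), ← mul_assoc, ih,
      glueList_comm m a b hab c d hcd hac had hbc hbd, mul_assoc]

/-- After gluing, the glued nodes are joined to each other. -/
theorem glueList_partner_left (m : LabelledMatching W G) (a b : ι → W) (hab : ∀ i, a i ≠ b i)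
    (ha : Function.Injective a) (hb : Function.Injective b) (hab' : ∀ i j, a i ≠ b j)
    (l : List ι) (i : ι) (hi : i ∈ l) : (m.glueList a b hab l).partner (a i) = b i := by
  induction l with
  | nil => simp at hi
  | cons j l ih =>
    by_cases hij : i = j
    · subst hij
      simp [glueList, glue]
    · have hi' := ih (by simpa [hij] using hi)
      have h1 := (m.glueList a b hab l).partner_partner
      have h4 := ha.ne hij
      have h5 := hb.ne hij
      have h6 := hab' i j
      have h7 := hab' j i
      simp only [glueList, glue]
      grind

/-- An edge that avoids all glued nodes stays. -/
theorem glueList_partner_of_forall_ne (m : LabelledMatching W G) (a b : ι → W)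
    (hab : ∀ i, a i ≠ b i) (v w : W) (hvw : m.partner v = w)
    (hv : ∀ i, a i ≠ v ∧ b i ≠ v) (hw : ∀ i, a i ≠ w ∧ b i ≠ w) (l : List ι) :
    (m.glueList a b hab l).partner v = w := by
  induction l with
  | nil => exact hvw
  | cons j l ih =>
    have h1 := (m.glueList a b hab l).partner_partner
    have h2 := hv j
    have h3 := hw j
    simp only [glueList, glue]
    grind

/-- Gluing on an edge with label `1` only moves the end of an edge. -/
theorem Induces.glue_update {f : U → W} (hf : Function.Injective f) {m' : LabelledMatching U G}
    {m : LabelledMatching W G} (h : Induces f m' m) (a c : W) (u : U) (hau : a ≠ f u)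
    (ha : ∀ v, f v ≠ a) (hc : ∀ v, f v ≠ c) (hac : m.partner a = c) (h1 : m.label a = 1) :
    Induces (Function.update f u c) m' (m.glue a (f u) hau) := by
  have hp := m.partner_partner
  have hne := m.partner_ne
  have hne' := m'.partner_ne
  have hp' := m'.partner_partner
  have hl' := m'.label_partner
  obtain ⟨h2, h3⟩ := h
  have hfi : ∀ v w, f v = f w ↔ v = w := fun v w => hf.eq_iff
  constructor
  · intro v
    simp only [LabelledMatching.glue, Function.update_apply]
    grind
  · intro v
    simp only [LabelledMatching.glue, Function.update_apply]
    grind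

theorem disjSum_glue_left (m : LabelledMatching W G) (m' : LabelledMatching W' G) (a b : W)
    (hab : a ≠ b) (hab' : (Sum.inl a : W ⊕ W') ≠ Sum.inl b) :
    (m.glue a b hab).disjSum m' = (m.disjSum m').glue (Sum.inl a) (Sum.inl b) hab' := by
  ext w
  · rcases w with w | w <;> simp [glue, disjSum]
    split_ifs <;> rfl
  · rcases w with w | w <;> simp [glue, disjSum]

theorem disjSum_glue_right (m : LabelledMatching W G) (m' : LabelledMatching W' G) (a b : W')
    (hab : a ≠ b) (hab' : (Sum.inr a : W ⊕ W') ≠ Sum.inr b) :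
    m.disjSum (m'.glue a b hab) = (m.disjSum m').glue (Sum.inr a) (Sum.inr b) hab' := by
  ext w
  · rcases w with w | w <;> simp [glue, disjSum]
    split_ifs <;> rfl
  · rcases w with w | w <;> simp [glue, disjSum]

theorem disjSum_glueList_left (m : LabelledMatching W G) (m' : LabelledMatching W' G) (a b : ι → W)
    (hab : ∀ i, a i ≠ b i) (hab' : ∀ i, (Sum.inl (a i) : W ⊕ W') ≠ Sum.inl (b i)) (l : List ι) :
    (m.glueList a b hab l).disjSum m' =
      (m.disjSum m').glueList (fun i => Sum.inl (a i)) (fun i => Sum.inl (b i)) hab' l := by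
  induction l with
  | nil => rfl
  | cons i l ih => simp only [glueList, ← ih, disjSum_glue_left _ _ _ _ (hab i) (hab' i)]

theorem disjSum_glueList_right (m : LabelledMatching W G) (m' : LabelledMatching W' G)
    (a b : ι → W')
    (hab : ∀ i, a i ≠ b i) (hab' : ∀ i, (Sum.inr (a i) : W ⊕ W') ≠ Sum.inr (b i)) (l : List ι) :
    m.disjSum (m'.glueList a b hab l) =
      (m.disjSum m').glueList (fun i => Sum.inr (a i)) (fun i => Sum.inr (b i)) hab' l := by
  induction l with
  | nil => rfl
  | cons i l ih => simp only [glueList, ← ih, disjSum_glue_right _ _ _ _ (hab i) (hab' i)]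

theorem induces_inl (m : LabelledMatching W G) (m' : LabelledMatching W' G) :
    Induces Sum.inl m (m.disjSum m') := ⟨fun _ => rfl, fun _ => rfl⟩

theorem induces_inr (m : LabelledMatching W G) (m' : LabelledMatching W' G) :
    Induces Sum.inr m' (m.disjSum m') := ⟨fun _ => rfl, fun _ => rfl⟩

theorem Induces.disjSum {f : U → W} {f' : V → W'} {m₁ : LabelledMatching U G}
    {m₂ : LabelledMatching W G} {m₁' : LabelledMatching V G} {m₂' : LabelledMatching W' G}
    (h : Induces f m₁ m₂) (h' : Induces f' m₁' m₂') :
    Induces (Sum.map f f') (m₁.disjSum m₁') (m₂.disjSum m₂') := by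
  constructor
  · rintro (u | u) <;> simp [LabelledMatching.disjSum, h.1, h'.1]
  · rintro (u | u) <;> simp [LabelledMatching.disjSum, h.2, h'.2]

end Lemmas

end LabelledMatching

/-- A `G`-Brauer `n`-diagram: a perfect matching, with edges labelled by `G`, of two columns of `n`
nodes. The node `i` of the left column is `Sum.inl i`, that of the right column is `Sum.inr i`. -/
abbrev GBrauerDiagram (G : Type u) (n : ℕ) : Type u := LabelledMatching (Fin n ⊕ Fin n) G

namespace GBrauerDiagram

variable {G k : Type u} [CommGroup G] [CommRing k] [MulSemiringAction G k] {n : ℕ}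

/-- The node `i` of the right column of the first of two diagrams. -/
def midLeft (i : Fin n) : (Fin n ⊕ Fin n) ⊕ (Fin n ⊕ Fin n) := Sum.inl (Sum.inr i)

/-- The node `i` of the left column of the second of two diagrams. -/
def midRight (i : Fin n) : (Fin n ⊕ Fin n) ⊕ (Fin n ⊕ Fin n) := Sum.inr (Sum.inl i)

theorem midLeft_ne_midRight (i j : Fin n) : midLeft i ≠ midRight j := Sum.inl_ne_inr

/-- The left column of the first of two diagrams and the right column of the second one. -/
def outer : Fin n ⊕ Fin n → (Fin n ⊕ Fin n) ⊕ (Fin n ⊕ Fin n) :=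
  Sum.map Sum.inl Sum.inr

theorem outer_injective : Function.Injective (outer (n := n)) :=
  Sum.map_injective.2 ⟨Sum.inl_injective, Sum.inr_injective⟩

/-- The diagrams `x` and `y` next to each other, with the right-hand nodes of `x` identified with
the left-hand nodes of `y`. -/
def concat (x y : GBrauerDiagram G n) : LabelledMatching ((Fin n ⊕ Fin n) ⊕ (Fin n ⊕ Fin n)) G :=
  (x.disjSum y).glueList midLeft midRight (fun i => midLeft_ne_midRight i i) (List.finRange n)

theorem concat_partner_outer (x y : GBrauerDiagram G n) (u : Fin n ⊕ Fin n) :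
    ∃ u', outer u' = (concat x y).partner (outer u) := by
  have key : ∀ i, (concat x y).partner (midLeft i) = midRight i := fun i =>
    LabelledMatching.glueList_partner_left _ _ _ _
      (fun i j h => by simpa [midLeft] using h) (fun i j h => by simpa [midRight] using h)
      midLeft_ne_midRight _ i (List.mem_finRange i)
  have h1 := (concat x y).partner_partner
  rcases h : (concat x y).partner (outer u) with (i | i) | (i | i)
  · exact ⟨Sum.inl i, rfl⟩
  · exfalso
    have h2 := h1 (outer u)
    rw [h, show Sum.inl (Sum.inr i) = midLeft i from rfl, key i] at h2
    rcases u with u | u <;> simp [outer, midRight] at h2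
  · exfalso
    have h2 := h1 (outer u)
    rw [h, show Sum.inr (Sum.inl i) = midRight i from rfl, ← key i, h1] at h2
    rcases u with u | u <;> simp [outer, midLeft] at h2
  · exact ⟨Sum.inr i, rfl⟩

/-- The composite of two diagrams, as a diagram: concatenate and forget the nodes in the middle. -/
noncomputable def comp (x y : GBrauerDiagram G n) : GBrauerDiagram G n :=
  (concat x y).restrict outer outer_injective (concat_partner_outer x y)

/-- The scalar by which the composite diagram of `x` and `y` is multiplied in the `G`-Brauer
algebra: the product of `g • δ` over all loops, where `g` is the product of the labels on the
loop. -/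
def weight (δ : k) (x y : GBrauerDiagram G n) : k :=
  (x.disjSum y).loopWeight δ midLeft midRight (fun i => midLeft_ne_midRight i i)
    (List.finRange n)

/-- The identity diagram: each left node is joined to the right node opposite to it, with
label `1`. -/
def one : GBrauerDiagram G n where
  partner := Sum.swap
  partner_partner := Sum.swap_swap
  partner_ne := by rintro (i | i) <;> simp
  label _ := 1
  label_partner _ := rfl

/-- The diagram has no left-to-left and no right-to-right connections. -/
def IsThrough (x : GBrauerDiagram G n) : Prop :=
  (∀ i, (x.partner (Sum.inl i)).isRight) ∧ ∀ i, (x.partner (Sum.inr i)).isLeft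

open LabelledMatching

set_option linter.unusedSectionVars false

theorem comp_induces (x y : GBrauerDiagram G n) : Induces outer (comp x y) (concat x y) :=
  restrict_induces _ _ _ _

theorem one_aux (δ : k) (y : GBrauerDiagram G n) (l : List (Fin n)) (hl : l.Nodup) :
    Induces (Sum.elim (fun i => if i ∈ l then Sum.inl (Sum.inl i) else Sum.inr (Sum.inl i))
        (fun i => Sum.inr (Sum.inr i))) y
      (((one : GBrauerDiagram G n).disjSum y).glueList midLeft midRight
        (fun i => midLeft_ne_midRight i i) l) ∧
    (∀ i ∉ l, (((one : GBrauerDiagram G n).disjSum y).glueList midLeft midRight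
        (fun i => midLeft_ne_midRight i i) l).partner (midLeft i) = Sum.inl (Sum.inl i) ∧
      (((one : GBrauerDiagram G n).disjSum y).glueList midLeft midRight
        (fun i => midLeft_ne_midRight i i) l).label (midLeft i) = 1) ∧
    ((one : GBrauerDiagram G n).disjSum y).loopWeight δ midLeft midRight
        (fun i => midLeft_ne_midRight i i) l = 1 := by
  induction l with
  | nil =>
    refine ⟨⟨?_, ?_⟩, ?_, rfl⟩
    · rintro (i | i) <;> rcases h : y.partner _ with j | j <;>
        simp [glueList, disjSum, h]
    · rintro (i | i) <;> simp [glueList, disjSum]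
    · intro i _
      simp [glueList, disjSum, one, midLeft]
  | cons i l ih =>
    obtain ⟨h1, h2, h3⟩ := ih (List.nodup_cons.1 hl).2
    have hi := (List.nodup_cons.1 hl).1
    set m := (((one : GBrauerDiagram G n).disjSum y).glueList midLeft midRight
        (fun i => midLeft_ne_midRight i i) l) with hm
    refine ⟨?_, ?_, ?_⟩
    · have hb : midRight i = Sum.elim (fun i => if i ∈ l then Sum.inl (Sum.inl i)
          else Sum.inr (Sum.inl i)) (fun i => Sum.inr (Sum.inr i)) (Sum.inl i) := by
        simp [midRight, hi]
      have := h1.glue_update ?_ (midLeft i) (Sum.inl (Sum.inl i)) (Sum.inl i) (hb ▸ midLeft_ne_midRight i i) ?_ ?_ (h2 i hi).1 (h2 i hi).2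
      · convert this using 1
        · funext v
          rcases v with j | j
          · by_cases hj : j = i
            · subst hj; simp
            · simp [Function.update_apply, hj]
          · simp [Function.update_apply]
        · simp only [glueList, ← hm]
          congr 1
      · rintro (a | a) (b | b) hab
        · grind
        · grind
        · grind
        · grind
      · rintro (v | v) <;> simp [midLeft]
        split_ifs <;> simp
      · rintro (v | v) <;> simp
        grind
    · intro j hj
      have hj1 : j ≠ i := by grind
      have hj2 : j ∉ l := by grind
      have hi2 := h2 i hi
      have hj3 := h2 j hj2
      have hp := m.partner_partner
      simp only [glueList, ← hm, glue]
      have e1 : midLeft j ≠ midLeft i := by simpa [midLeft] using hj1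
      have e2 := midLeft_ne_midRight j i
      have e3 : (midLeft j : (Fin n ⊕ Fin n) ⊕ (Fin n ⊕ Fin n)) ≠ Sum.inl (Sum.inl i) := by
        simp [midLeft]
      have e4 : (midRight i : (Fin n ⊕ Fin n) ⊕ (Fin n ⊕ Fin n)) ≠ Sum.inl (Sum.inl j) := by
        simp [midRight]
      grind
    · simp only [loopWeight, h3, ← hm, loopFactor, (h2 i hi).1]
      simp [midRight]

theorem aux_one (δ : k) (y : GBrauerDiagram G n) (l : List (Fin n)) (hl : l.Nodup) :
    Induces (Sum.elim (fun i => Sum.inl (Sum.inl i))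
        (fun i => if i ∈ l then Sum.inr (Sum.inr i) else Sum.inl (Sum.inr i))) y
      ((y.disjSum (one : GBrauerDiagram G n)).glueList midLeft midRight
        (fun i => midLeft_ne_midRight i i) l) ∧
    (∀ i ∉ l, ((y.disjSum (one : GBrauerDiagram G n)).glueList midLeft midRight
        (fun i => midLeft_ne_midRight i i) l).partner (midRight i) = Sum.inr (Sum.inr i) ∧
      ((y.disjSum (one : GBrauerDiagram G n)).glueList midLeft midRight
        (fun i => midLeft_ne_midRight i i) l).label (midRight i) = 1) ∧
    (y.disjSum (one : GBrauerDiagram G n)).loopWeight δ midLeft midRight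
        (fun i => midLeft_ne_midRight i i) l = 1 := by
  induction l with
  | nil =>
    refine ⟨⟨?_, ?_⟩, ?_, rfl⟩
    · rintro (i | i) <;> rcases h : y.partner _ with j | j <;>
        simp [glueList, disjSum, h]
    · rintro (i | i) <;> simp [glueList, disjSum]
    · intro i _
      simp [glueList, disjSum, one, midRight]
  | cons i l ih =>
    obtain ⟨h1, h2, h3⟩ := ih (List.nodup_cons.1 hl).2
    have hi := (List.nodup_cons.1 hl).1
    set m := ((y.disjSum (one : GBrauerDiagram G n)).glueList midLeft midRight
        (fun i => midLeft_ne_midRight i i) l) with hm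
    refine ⟨?_, ?_, ?_⟩
    · have hb : midLeft i = Sum.elim (fun i => Sum.inl (Sum.inl i)) (fun i => if i ∈ l then
          Sum.inr (Sum.inr i) else Sum.inl (Sum.inr i)) (Sum.inr i) := by
        simp [midLeft, hi]
      have := h1.glue_update ?_ (midRight i) (Sum.inr (Sum.inr i)) (Sum.inr i)
        (hb ▸ (midLeft_ne_midRight i i).symm) ?_ ?_ (h2 i hi).1 (h2 i hi).2
      · convert this using 1
        · funext v
          rcases v with j | j
          · simp [Function.update_apply]
          · by_cases hj : j = i
            · subst hj; simp
            · simp [Function.update_apply, hj]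
        · simp only [glueList, ← hm]
          rw [glue_symm]
          congr 1
      · rintro (a | a) (b | b) hab
        · grind
        · grind
        · grind
        · grind
      · rintro (v | v) <;> simp [midRight]
        split_ifs <;> simp
      · rintro (v | v) <;> simp
        grind
    · intro j hj
      have hj1 : j ≠ i := by grind
      have hj2 : j ∉ l := by grind
      have hi2 := h2 i hi
      have hj3 := h2 j hj2
      have hp := m.partner_partner
      simp only [glueList, ← hm, glue]
      have e1 : midRight j ≠ midRight i := by simpa [midRight] using hj1
      have e2 := midLeft_ne_midRight i j
      have e3 : (midRight j : (Fin n ⊕ Fin n) ⊕ (Fin n ⊕ Fin n)) ≠ Sum.inr (Sum.inr i) := by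
        simp [midRight]
      have e4 : (midLeft i : (Fin n ⊕ Fin n) ⊕ (Fin n ⊕ Fin n)) ≠ Sum.inr (Sum.inr j) := by
        simp [midLeft]
      grind
    · simp only [loopWeight, h3, ← hm]
      rw [loopFactor_symm]
      simp only [loopFactor, (h2 i hi).1]
      simp [midLeft]

theorem one_comp (δ : k) (y : GBrauerDiagram G n) : comp one y = y ∧ weight δ one y = 1 := by
  have h := one_aux δ y (List.finRange n) (List.nodup_finRange n)
  refine ⟨(comp_induces one y).unique outer_injective ?_, h.2.2⟩
  convert h.1 using 1
  · funext v
    rcases v with v | v <;> simp [outer]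
  · rfl

theorem comp_one (δ : k) (y : GBrauerDiagram G n) : comp y one = y ∧ weight δ y one = 1 := by
  have h := aux_one δ y (List.finRange n) (List.nodup_finRange n)
  refine ⟨(comp_induces y one).unique outer_injective ?_, h.2.2⟩
  convert h.1 using 1
  · funext v
    rcases v with v | v <;> simp [outer]
  · rfl

theorem assoc_aux (δ : k) (x y z : GBrauerDiagram G n) :
    comp (comp x y) z = comp x (comp y z) ∧
    weight δ x y * weight δ (comp x y) z = weight δ y z * weight δ x (comp y z) := by
  set N := Fin n ⊕ Fin n
  let a₁ : Fin n → (N ⊕ N) ⊕ N := fun i => Sum.inl (Sum.inl (Sum.inr i))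
  let b₁ : Fin n → (N ⊕ N) ⊕ N := fun i => Sum.inl (Sum.inr (Sum.inl i))
  let a₂ : Fin n → (N ⊕ N) ⊕ N := fun i => Sum.inl (Sum.inr (Sum.inr i))
  let b₂ : Fin n → (N ⊕ N) ⊕ N := fun i => Sum.inr (Sum.inl i)
  have hab₁ : ∀ i, a₁ i ≠ b₁ i := by intro i; simp [a₁, b₁]
  have hab₂ : ∀ i, a₂ i ≠ b₂ i := by intro i; simp [a₂, b₂]
  let l := List.finRange n
  let m : LabelledMatching ((N ⊕ N) ⊕ N) G := (x.disjSum y).disjSum z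
  have hcomm : (m.glueList a₁ b₁ hab₁ l).glueList a₂ b₂ hab₂ l =
      (m.glueList a₂ b₂ hab₂ l).glueList a₁ b₁ hab₁ l :=
    glueList_comm m a₂ b₂ hab₂ a₁ b₁ hab₁ (by simp [a₁, a₂]) (by simp [a₂, b₁])
      (by simp [b₂, a₁]) (by simp [b₂, b₁]) l l
  have hwcomm := loopWeight_comm δ m a₂ b₂ hab₂ a₁ b₁ hab₁ (by simp [a₁, a₂]) (by simp [a₂, b₁])
      (by simp [b₂, a₁]) (by simp [b₂, b₁]) l l
  let F : N ⊕ N → (N ⊕ N) ⊕ N := Sum.map outer id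
  have hF : Function.Injective F := Sum.map_injective.2 ⟨outer_injective, Function.injective_id⟩
  have hL : Induces F ((comp x y).disjSum z) (m.glueList a₁ b₁ hab₁ l) := by
    have h := (comp_induces x y).disjSum (show Induces id z z from ⟨fun _ => rfl, fun _ => rfl⟩)
    unfold concat at h
    rw [disjSum_glueList_left] at h
    exact h
  have hL1 : weight δ x y = m.loopWeight δ a₁ b₁ hab₁ l :=
    ((induces_inl (x.disjSum y) z).loopWeight Sum.inl_injective δ midLeft midRight _ hab₁ l).symm
  have hL2 : weight δ (comp x y) z = (m.glueList a₁ b₁ hab₁ l).loopWeight δ a₂ b₂ hab₂ l :=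
    (hL.loopWeight hF δ midLeft midRight _ hab₂ l).symm
  have hL3 := (comp_induces (comp x y) z).comp (hL.glueList hF midLeft midRight _ hab₂ l)
  let e : N ⊕ (N ⊕ N) → (N ⊕ N) ⊕ N := (Equiv.sumAssoc N N N).symm
  have he : Function.Injective e := (Equiv.sumAssoc N N N).symm.injective
  have hm : Induces e (x.disjSum (y.disjSum z)) m := by
    constructor <;> rintro (u | u | u) <;> rfl
  let F' : N ⊕ N → (N ⊕ N) ⊕ N := e ∘ Sum.map id outer
  have hF' : Function.Injective F' :=
    he.comp (Sum.map_injective.2 ⟨Function.injective_id, outer_injective⟩)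
  have hR : Induces F' (x.disjSum (comp y z)) (m.glueList a₂ b₂ hab₂ l) := by
    have h := (show Induces id x x from ⟨fun _ => rfl, fun _ => rfl⟩).disjSum (comp_induces y z)
    unfold concat at h
    rw [disjSum_glueList_right _ _ _ _ _ (by intro i; simp [midLeft, midRight])] at h
    exact h.comp (hm.glueList he _ _ _ hab₂ l)
  have hR1 : weight δ y z = m.loopWeight δ a₂ b₂ hab₂ l :=
    (((induces_inr x (y.disjSum z)).comp hm).loopWeight (he.comp Sum.inr_injective) δ
      midLeft midRight _ hab₂ l).symm
  have hR2 : weight δ x (comp y z) = (m.glueList a₂ b₂ hab₂ l).loopWeight δ a₁ b₁ hab₁ l :=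
    (hR.loopWeight hF' δ midLeft midRight _ hab₁ l).symm
  have hR3 := (comp_induces x (comp y z)).comp (hR.glueList hF' midLeft midRight _ hab₁ l)
  refine ⟨?_, by rw [hL1, hL2, hR1, hR2, hwcomm]⟩
  refine hL3.unique (hF.comp outer_injective) ?_
  convert hR3 using 1
  · funext v
    rcases v with v | v <;> rfl
  · exact hcomm

theorem IsThrough.left_iff (x : GBrauerDiagram G n) :
    x.IsThrough ↔ ∀ i, (x.partner (Sum.inl i)).isRight := by
  refine ⟨fun h => h.1, fun h => ⟨h, ?_⟩⟩
  choose f hf using fun i => Sum.isRight_iff.1 (h i)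
  have hinj : Function.Injective f := by
    intro i j hij
    have := (x.partner_partner (Sum.inl i)).symm
    rw [hf, hij, ← hf, x.partner_partner] at this
    exact Sum.inl_injective this
  intro j
  obtain ⟨i, rfl⟩ := Finite.surjective_of_injective hinj j
  rw [← hf, x.partner_partner]
  rfl

theorem IsThrough.right_iff (x : GBrauerDiagram G n) :
    x.IsThrough ↔ ∀ i, (x.partner (Sum.inr i)).isLeft := by
  refine ⟨fun h => h.2, fun h => ⟨?_, h⟩⟩
  choose f hf using fun i => Sum.isLeft_iff.1 (h i)
  have hinj : Function.Injective f := by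
    intro i j hij
    have := (x.partner_partner (Sum.inr i)).symm
    rw [hf, hij, ← hf, x.partner_partner] at this
    exact Sum.inr_injective this
  intro j
  obtain ⟨i, rfl⟩ := Finite.surjective_of_injective hinj j
  rw [← hf, x.partner_partner]
  rfl

theorem IsThrough.of_comp {x y : GBrauerDiagram G n} (h : (comp x y).IsThrough) :
    x.IsThrough ∧ y.IsThrough := by
  have hc := (comp_induces x y).1
  constructor
  · rw [IsThrough.left_iff]
    intro i
    by_contra hi
    obtain ⟨j, hj⟩ : ∃ j, x.partner (Sum.inl i) = Sum.inl j := by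
      rcases hx : x.partner (Sum.inl i) with j | j
      · exact ⟨j, rfl⟩
      · simp [hx] at hi
    have h1 : (concat x y).partner (outer (Sum.inl i)) = outer (Sum.inl j) :=
      glueList_partner_of_forall_ne _ _ _ _ _ _ (by simp [disjSum, outer, hj])
        (by simp [midLeft, midRight, outer]) (by simp [midLeft, midRight, outer]) _
    rw [hc] at h1
    have h2 := h.1 i
    rw [outer_injective h1] at h2
    simp at h2
  · rw [IsThrough.right_iff]
    intro i
    by_contra hi
    obtain ⟨j, hj⟩ : ∃ j, y.partner (Sum.inr i) = Sum.inr j := by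
      rcases hx : y.partner (Sum.inr i) with j | j
      · simp [hx] at hi
      · exact ⟨j, rfl⟩
    have h1 : (concat x y).partner (outer (Sum.inr i)) = outer (Sum.inr j) :=
      glueList_partner_of_forall_ne _ _ _ _ _ _ (by simp [disjSum, outer, hj])
        (by simp [midLeft, midRight, outer]) (by simp [midLeft, midRight, outer]) _
    rw [hc] at h1
    have h2 := h.2 i
    rw [outer_injective h1] at h2
    simp at h2

theorem IsThrough.comp_aux (δ : k) {x y : GBrauerDiagram G n} (hx : x.IsThrough)
    (hy : y.IsThrough) (l : List (Fin n)) (hl : l.Nodup) (m) (hm : m =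
      (x.disjSum y).glueList midLeft midRight (fun i => midLeft_ne_midRight i i) l) :
    (∀ i, (∃ j, j ∉ l ∧ m.partner (Sum.inl (Sum.inl i)) = midLeft j) ∨
        ∃ j, m.partner (Sum.inl (Sum.inl i)) = Sum.inr (Sum.inr j)) ∧
    (∀ i ∉ l, ∃ j, m.partner (midLeft i) = Sum.inl (Sum.inl j)) ∧
    (∀ i ∉ l, ∃ j, m.partner (midRight i) = Sum.inr (Sum.inr j)) ∧
    (x.disjSum y).loopWeight δ midLeft midRight (fun i => midLeft_ne_midRight i i) l = 1 := by
  induction l generalizing m with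
  | nil =>
    subst hm
    refine ⟨fun i => Or.inl ?_, fun i _ => ?_, fun i _ => ?_, rfl⟩
    · obtain ⟨j, hj⟩ := Sum.isRight_iff.1 (hx.1 i)
      exact ⟨j, by simp, by simp [glueList, disjSum, hj, midLeft]⟩
    · obtain ⟨j, hj⟩ := Sum.isLeft_iff.1 (hx.2 i)
      exact ⟨j, by simp [glueList, disjSum, hj, midLeft]⟩
    · obtain ⟨j, hj⟩ := Sum.isRight_iff.1 (hy.1 i)
      exact ⟨j, by simp [glueList, disjSum, hj, midRight]⟩
  | cons i l ih =>
    obtain ⟨h1, h2, h3, h4⟩ := ih (List.nodup_cons.1 hl).2 _ rfl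
    have hi := (List.nodup_cons.1 hl).1
    simp only [glueList] at hm
    set m' := (x.disjSum y).glueList midLeft midRight (fun i => midLeft_ne_midRight i i) l with hm'
    have hp := m'.partner_partner
    obtain ⟨c, hc⟩ := h2 i hi
    obtain ⟨d, hd⟩ := h3 i hi
    have inj1 : ∀ p q : Fin n, midLeft p = midLeft q ↔ p = q := by simp [midLeft]
    have inj2 : ∀ p q : Fin n, midRight p = midRight q ↔ p = q := by simp [midRight]
    have ne1 : ∀ p q : Fin n, midLeft p ≠ midRight q := midLeft_ne_midRight
    have ne2 : ∀ p q : Fin n, midLeft p ≠ Sum.inl (Sum.inl q) := by simp [midLeft]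
    have ne3 : ∀ p q : Fin n, midLeft p ≠ Sum.inr (Sum.inr q) := by simp [midLeft]
    have ne4 : ∀ p q : Fin n, midRight p ≠ Sum.inl (Sum.inl q) := by simp [midRight]
    have ne5 : ∀ p q : Fin n, midRight p ≠ Sum.inr (Sum.inr q) := by simp [midRight]
    subst hm
    refine ⟨fun j => ?_, fun j hj => ?_, fun j hj => ?_, ?_⟩
    · by_cases hjc : j = c
      · right
        refine ⟨d, ?_⟩
        subst hjc
        simp only [glue]
        grind
      · have e : (m'.glue (midLeft i) (midRight i) (midLeft_ne_midRight i i)).partner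
            (Sum.inl (Sum.inl j)) = m'.partner (Sum.inl (Sum.inl j)) := by
          simp only [glue]
          grind
        rw [e]
        rcases h1 j with ⟨q, hq, hq'⟩ | h
        · left
          refine ⟨q, ?_, hq'⟩
          have : q ≠ i := by
            rintro rfl
            rw [← hq', hp] at hc
            exact hjc (by simpa using hc)
          grind
        · exact Or.inr h
    · obtain ⟨q, hq⟩ := h2 j (by grind)
      refine ⟨q, ?_⟩
      simp only [glue]
      grind
    · obtain ⟨q, hq⟩ := h3 j (by grind)
      refine ⟨q, ?_⟩
      simp only [glue]
      grind
    · simp only [loopWeight, h4, ← hm', loopFactor, hc]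
      rw [if_neg (ne4 i c).symm, one_mul]

theorem IsThrough.comp (δ : k) {x y : GBrauerDiagram G n} (hx : x.IsThrough)
    (hy : y.IsThrough) : (comp x y).IsThrough ∧ weight δ x y = 1 := by
  obtain ⟨h1, -, -, h4⟩ := IsThrough.comp_aux δ hx hy (List.finRange n) (List.nodup_finRange n) _ rfl
  refine ⟨?_, h4⟩
  rw [IsThrough.left_iff]
  intro i
  rcases h1 i with ⟨j, hj, -⟩ | ⟨j, hj⟩
  · simp at hj
  · have h := (comp_induces x y).1 (Sum.inl i)
    have h' : (concat x y).partner (outer (Sum.inl i)) = outer (Sum.inr j) := hj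
    rw [h] at h'
    rw [outer_injective h']
    rfl

end GBrauerDiagram

/-- The `G`-Brauer algebra: formal `k`-linear combinations of `G`-Brauer `n`-diagrams. The
parameter `δ` enters the multiplication only. -/
def GBrauerAlgebra {k : Type u} [CommRing k] (G : Type u) (n : ℕ) (_δ : k) : Type u :=
  GBrauerDiagram G n →₀ k

namespace GBrauerAlgebra

variable {G k : Type u} [CommGroup G] [CommRing k] [MulSemiringAction G k] {n : ℕ} {δ : k}

set_option linter.unusedSectionVars false

noncomputable instance : AddCommGroup (GBrauerAlgebra G n δ) :=
  inferInstanceAs (AddCommGroup (GBrauerDiagram G n →₀ k))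

noncomputable instance : Module k (GBrauerAlgebra G n δ) :=
  inferInstanceAs (Module k (GBrauerDiagram G n →₀ k))

/-- A diagram as an element of the `G`-Brauer algebra. -/
noncomputable def ofDiagram (δ : k) (x : GBrauerDiagram G n) : GBrauerAlgebra G n δ :=
  Finsupp.single x 1

/-- The bilinear extension of `x * y = weight δ x y • comp x y`. -/
noncomputable def mulHom (G : Type u) [CommGroup G] [MulSemiringAction G k] (n : ℕ) (δ : k) :
    GBrauerAlgebra G n δ →ₗ[k] GBrauerAlgebra G n δ →ₗ[k] GBrauerAlgebra G n δ :=
  Finsupp.linearCombination k fun x => Finsupp.linearCombination k fun y =>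
    GBrauerDiagram.weight δ x y • ofDiagram δ (GBrauerDiagram.comp x y)

theorem mulHom_ofDiagram (x y : GBrauerDiagram G n) :
    mulHom G n δ (ofDiagram δ x) (ofDiagram δ y) =
      GBrauerDiagram.weight δ x y • ofDiagram δ (GBrauerDiagram.comp x y) := by
  have h1 : mulHom G n δ (ofDiagram δ x) = Finsupp.linearCombination k fun y =>
    GBrauerDiagram.weight δ x y • ofDiagram δ (GBrauerDiagram.comp x y) :=
    (Finsupp.linearCombination_single ..).trans (one_smul ..)
  rw [h1]
  exact (Finsupp.linearCombination_single ..).trans (one_smul ..)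

theorem hom_ext {M : Type*} [AddCommMonoid M] [Module k M] {f g : GBrauerAlgebra G n δ →ₗ[k] M}
    (h : ∀ x, f (ofDiagram δ x) = g (ofDiagram δ x)) : f = g :=
  Finsupp.lhom_ext' fun x => LinearMap.ext_ring (h x)

noncomputable instance : Mul (GBrauerAlgebra G n δ) := ⟨fun a b => mulHom G n δ a b⟩

noncomputable instance : One (GBrauerAlgebra G n δ) := ⟨ofDiagram δ GBrauerDiagram.one⟩

theorem mul_def (a b : GBrauerAlgebra G n δ) : a * b = mulHom G n δ a b := rfl

theorem ofDiagram_mul (x y : GBrauerDiagram G n) :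
    ofDiagram δ x * ofDiagram δ y =
      GBrauerDiagram.weight δ x y • ofDiagram δ (GBrauerDiagram.comp x y) :=
  mulHom_ofDiagram x y

theorem one_def : (1 : GBrauerAlgebra G n δ) = ofDiagram δ GBrauerDiagram.one := rfl

theorem mul_assoc' (a b c : GBrauerAlgebra G n δ) : a * b * c = a * (b * c) := by
  suffices h : (mulHom G n δ).flip c ∘ₗ (mulHom G n δ).flip b = (mulHom G n δ).flip (b * c) from
    LinearMap.congr_fun h a
  refine hom_ext fun x => ?_
  suffices h : (mulHom G n δ).flip c ∘ₗ mulHom G n δ (ofDiagram δ x) =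
      mulHom G n δ (ofDiagram δ x) ∘ₗ (mulHom G n δ).flip c from LinearMap.congr_fun h b
  refine hom_ext fun y => ?_
  suffices h : mulHom G n δ (ofDiagram δ x * ofDiagram δ y) =
      mulHom G n δ (ofDiagram δ x) ∘ₗ mulHom G n δ (ofDiagram δ y) from LinearMap.congr_fun h c
  refine hom_ext fun z => ?_
  have h := GBrauerDiagram.assoc_aux δ x y z
  simp only [LinearMap.comp_apply, ofDiagram_mul, mulHom_ofDiagram, map_smul,
    LinearMap.smul_apply, smul_smul, h.1, h.2]

theorem one_mul' (a : GBrauerAlgebra G n δ) : 1 * a = a := by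
  have h : mulHom G n δ 1 = LinearMap.id := hom_ext fun x => by
    rw [one_def, mulHom_ofDiagram, (GBrauerDiagram.one_comp δ x).1,
      (GBrauerDiagram.one_comp δ x).2, one_smul, LinearMap.id_apply]
  exact LinearMap.congr_fun h a

theorem mul_one' (a : GBrauerAlgebra G n δ) : a * 1 = a := by
  have h : (mulHom G n δ).flip 1 = LinearMap.id := hom_ext fun x => by
    rw [LinearMap.flip_apply, one_def, mulHom_ofDiagram, (GBrauerDiagram.comp_one δ x).1,
      (GBrauerDiagram.comp_one δ x).2, one_smul, LinearMap.id_apply]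
  exact LinearMap.congr_fun h a

noncomputable instance : Ring (GBrauerAlgebra G n δ) where
  __ := (inferInstance : AddCommGroup (GBrauerAlgebra G n δ))
  mul_assoc := mul_assoc'
  one_mul := one_mul'
  mul_one := mul_one'
  left_distrib a b c := by simp only [mul_def, map_add]
  right_distrib a b c := by simp only [mul_def, map_add, LinearMap.add_apply]
  zero_mul a := by simp only [mul_def, map_zero, LinearMap.zero_apply]
  mul_zero a := by simp only [mul_def, map_zero]

noncomputable instance : Algebra k (GBrauerAlgebra G n δ) :=
  Algebra.ofModule (fun r a b => by simp only [mul_def, map_smul, LinearMap.smul_apply])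
    (fun r a b => by simp only [mul_def, map_smul])

open Classical in
/-- The linear map underlying `augmentation`. -/
noncomputable def augmentationLinear (G : Type u) [CommGroup G] (n : ℕ) (δ : k) :
    GBrauerAlgebra G n δ →ₗ[k] k :=
  Finsupp.linearCombination k fun x : GBrauerDiagram G n => if x.IsThrough then (1 : k) else 0

open Classical in
theorem augmentationLinear_ofDiagram (x : GBrauerDiagram G n) :
    augmentationLinear G n δ (ofDiagram δ x) = if x.IsThrough then (1 : k) else 0 :=
  (Finsupp.linearCombination_single ..).trans (one_smul ..)

theorem augmentationLinear_mul (a b : GBrauerAlgebra G n δ) :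
    augmentationLinear G n δ (a * b) =
      augmentationLinear G n δ a * augmentationLinear G n δ b := by
  suffices h : augmentationLinear G n δ ∘ₗ (mulHom G n δ).flip b =
      (LinearMap.mul k k).flip (augmentationLinear G n δ b) ∘ₗ augmentationLinear G n δ from
    LinearMap.congr_fun h a
  refine hom_ext fun x => ?_
  suffices h : augmentationLinear G n δ ∘ₗ mulHom G n δ (ofDiagram δ x) =
      (LinearMap.mul k k (augmentationLinear G n δ (ofDiagram δ x))) ∘ₗ
        augmentationLinear G n δ from
    LinearMap.congr_fun h b
  refine hom_ext fun y => ?_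
  simp only [LinearMap.comp_apply, mulHom_ofDiagram, map_smul, LinearMap.mul_apply',
    augmentationLinear_ofDiagram, smul_eq_mul]
  by_cases hx : x.IsThrough
  · by_cases hy : y.IsThrough
    · have h := GBrauerDiagram.IsThrough.comp δ hx hy
      rw [if_pos hx, if_pos hy, if_pos h.1, h.2]
    · rw [if_neg hy, if_neg fun h => hy (GBrauerDiagram.IsThrough.of_comp h).2, mul_zero, mul_zero]
  · rw [if_neg hx, if_neg fun h => hx (GBrauerDiagram.IsThrough.of_comp h).1, mul_zero, zero_mul]

/-- The augmentation: diagrams with no left-to-left and no right-to-right connections are sent to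
`1`, all other diagrams to `0`. -/
noncomputable def augmentation (G : Type u) [CommGroup G] [MulSemiringAction G k] (n : ℕ) (δ : k) :
    GBrauerAlgebra G n δ →ₐ[k] k :=
  AlgHom.ofLinearMap (augmentationLinear G n δ)
    (by
      rw [one_def, augmentationLinear_ofDiagram, if_pos]
      exact ⟨fun _ => rfl, fun _ => rfl⟩)
    augmentationLinear_mul

end GBrauerAlgebra

section Tor

open CategoryTheory TensorProduct

/-- For a right module `M` and a left module `N` over a (noncommutative) `k`-algebra `A`, the
submodule of `M ⊗_k N` spanned by the elements `m a ⊗ x - m ⊗ a x`. The quotient by it is the tensor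
product `M ⊗_A N`, as a `k`-module. -/
abbrev BalancedTensor.relations (k A M N : Type u) [CommRing k] [Ring A] [Algebra k A]
    [AddCommGroup M] [Module k M] [Module Aᵐᵒᵖ M] [AddCommGroup N] [Module k N] [Module A N] :
    Submodule k (M ⊗[k] N) :=
  Submodule.span k
    {t | ∃ (m : M) (a : A) (x : N), t = (MulOpposite.op a • m) ⊗ₜ[k] x - m ⊗ₜ[k] (a • x)}

/-- The functor `N ↦ M ⊗_A N` from left `A`-modules to `k`-modules, where `M` is a right `A`-module
and `k` acts on a left `A`-module through `k → A`. -/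
noncomputable def balancedTensorFunctor (k A M : Type u) [CommRing k] [Ring A] [Algebra k A]
    [AddCommGroup M] [Module k M] [Module Aᵐᵒᵖ M] [IsScalarTower k Aᵐᵒᵖ M] :
    ModuleCat.{u} A ⥤ ModuleCat.{u} k where
  obj N :=
    letI : Module k N := Module.compHom N (algebraMap k A)
    ModuleCat.of k ((M ⊗[k] N) ⧸ BalancedTensor.relations k A M N)
  map {N N'} f :=
    letI : Module k N := Module.compHom N (algebraMap k A)
    letI : Module k N' := Module.compHom N' (algebraMap k A)
    letI f' : N →ₗ[k] N' :=
      { toFun := f.hom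
        map_add' := map_add f.hom
        map_smul' := fun r x => map_smul f.hom (algebraMap k A r) x }
    ModuleCat.ofHom (Submodule.mapQ _ _ (f'.lTensor M) (by
      rw [Submodule.span_le]
      rintro _ ⟨m, a, x, rfl⟩
      refine Submodule.subset_span ⟨m, a, f.hom x, ?_⟩
      simp [f']))
  map_id N := by
    letI : Module k N := Module.compHom N (algebraMap k A)
    apply ModuleCat.hom_ext
    apply Submodule.linearMap_qext
    apply TensorProduct.ext'
    intro m x
    rfl
  map_comp {N N' N''} f g := by
    letI : Module k N := Module.compHom N (algebraMap k A)
    letI : Module k N' := Module.compHom N' (algebraMap k A)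
    letI : Module k N'' := Module.compHom N'' (algebraMap k A)
    apply ModuleCat.hom_ext
    apply Submodule.linearMap_qext
    apply TensorProduct.ext'
    intro m x
    rfl

instance (k A M : Type u) [CommRing k] [Ring A] [Algebra k A]
    [AddCommGroup M] [Module k M] [Module Aᵐᵒᵖ M] [IsScalarTower k Aᵐᵒᵖ M] :
    (balancedTensorFunctor k A M).Additive where
  map_add {N N' f g} := by
    letI : Module k N := Module.compHom N (algebraMap k A)
    letI : Module k N' := Module.compHom N' (algebraMap k A)
    apply ModuleCat.hom_ext
    apply Submodule.linearMap_qext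
    apply TensorProduct.ext'
    intro m x
    exact congrArg (Submodule.Quotient.mk (p := BalancedTensor.relations k A M N'))
      (TensorProduct.tmul_add m (f.hom x) (g.hom x))

/-- `Tor_q^A(M, N)` for a right `A`-module `M` and a left `A`-module `N`: the `q`-th left derived
functor of `M ⊗_A -`, applied to `N`. -/
noncomputable def algebraTor (k A M N : Type u) [CommRing k] [Ring A] [Algebra k A]
    [AddCommGroup M] [Module k M] [Module Aᵐᵒᵖ M] [IsScalarTower k Aᵐᵒᵖ M]
    [AddCommGroup N] [Module A N] (q : ℕ) :
    ModuleCat.{u} k :=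
  ((balancedTensorFunctor k A M).leftDerived q).obj (ModuleCat.of A N)

end Tor

/-- The trivial module `k` of a `k`-algebra `A` with augmentation `ε : A → k`, on which `a : A`
acts, from the left and from the right, as multiplication by `ε a`. -/
def TrivialModule {k A : Type u} [CommRing k] [Ring A] [Algebra k A] (_ε : A →ₐ[k] k) : Type u := k

namespace TrivialModule

variable {k A : Type u} [CommRing k] [Ring A] [Algebra k A] (ε : A →ₐ[k] k)

instance : AddCommGroup (TrivialModule ε) := inferInstanceAs (AddCommGroup k)

instance : Module k (TrivialModule ε) := inferInstanceAs (Module k k)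

instance : Module A (TrivialModule ε) := Module.compHom k ε.toRingHom

instance : Module Aᵐᵒᵖ (TrivialModule ε) :=
  Module.compHom k (ε.toRingHom.fromOpposite fun _ _ => mul_comm _ _)

instance : IsScalarTower k Aᵐᵒᵖ (TrivialModule ε) where
  smul_assoc r a (x : k) := by
    change (ε (r • a.unop) * x : k) = r * (ε a.unop * x)
    rw [map_smul, smul_eq_mul, mul_assoc]

end TrivialModule

/-- `Tor^A_q(𝟙, 𝟙)` for the trivial module `𝟙` of a `k`-algebra with augmentation `ε`. -/
noncomputable abbrev trivialTor {k A : Type u} [CommRing k] [Ring A] [Algebra k A] (ε : A →ₐ[k] k)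
    (q : ℕ) : ModuleCat.{u} k :=
  algebraTor k A (TrivialModule ε) (TrivialModule ε) q

/-- The semi-direct product `G^n ⋊ Σ_n`, where `Σ_n` permutes the factors of `G^n`:
`σ` sends `(g_i)` to the tuple with entries `g_{σ⁻¹ i}`. -/
abbrev SymmSemidirect (G : Type u) [Group G] (n : ℕ) : Type u :=
  (Fin n → G) ⋊[mulAutArrow] Equiv.Perm (Fin n)

/-- The augmentation of a group algebra, which sends each group element to `1`. -/
noncomputable def groupAugmentation (k H : Type u) [CommRing k] [Group H] :
    MonoidAlgebra k H →ₐ[k] k :=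
  MonoidAlgebra.lift k k H 1

/-! Write `A` for the `G`-Brauer algebra, `B` for `k[G^n ⋊ Σ_n]`, `φ : A → B` for the map that kills
the diagrams that are not through, and `I` for its kernel. A composite with a non-through factor is
not through, so `φ` is multiplicative; the through diagrams multiply as in `G^n ⋊ Σ_n`, which splits
`φ`. The augmentation of `A` factors through `φ`, hence `𝟙 ⊗_A M = 𝟙 ⊗_B (M / I M)`, and `M / I M`
is projective over `B` if `M` is projective over `A`. So for a projective resolution `P` of `𝟙` over
`A`, the first isomorphism follows once `I P` is acyclic: then `P / I P` is again a resolution of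
`𝟙` (`trivialTorReductionIso`).

The ideal `I` is the sum of the right ideals `E_L` (`leftEdgeIdeal`) spanned by the diagrams that
contain a given nonempty list `L` of labelled left edges. Being spanned by basis elements, they
satisfy `E_L ∩ E_L' = E_(L ++ L')`, and their intersections distribute over sums. If a right ideal
`E` inside `I` has a left identity `e`, then `E P` is acyclic: a cycle `x` in `E P` bounds in `P`,
say `x = d w`, and then `x = e x = d (e w)`. A Mayer-Vietoris induction extends this to finite sums
of the `E_L` (`listSup_exact`); projectivity of `P` enters through `J M ∩ K M = (J ∩ K) M`.

Oddness of `n` is what provides the left identities (`exists_left_unit`). If some diagram realises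
`L`, then in that diagram a left node `c` is joined to the right column, so `c` lies on no edge of
`L`. This spare node allows, for each edge of `L`, a diagram `absorber` that fixes from the left
every diagram with this edge, without creating loops, so that `δ` plays no role. A product of
absorbers is a left identity of `E_L`.

The second isomorphism holds for every group `H`: `𝟙 ⊗_(k[H]) V` is naturally the module of
coinvariants `(k ⊗ V)_H`, and the bar resolution computes both sides (`trivialTorIsoGroupHomology`).
-/

/-! ### Right ideals with left identities, and acyclicity by Mayer-Vietoris -/

section MayerVietoris

variable {A : Type u} [Ring A]

/-- The additive subgroup `J M` of a left module `M`, for a right ideal `J`. -/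
def rightIdealSMul (J : Submodule Aᵐᵒᵖ A) (M : Type u) [AddCommGroup M] [Module A M] :
    AddSubgroup M :=
  AddSubgroup.closure {x | ∃ r ∈ J, ∃ m : M, r • m = x}

variable {M N : Type u} [AddCommGroup M] [Module A M] [AddCommGroup N] [Module A N]

theorem smul_mem_rightIdealSMul {J : Submodule Aᵐᵒᵖ A} {r : A} (hr : r ∈ J) (m : M) :
    r • m ∈ rightIdealSMul J M :=
  AddSubgroup.subset_closure ⟨r, hr, m, rfl⟩

theorem rightIdealSMul_mono {J K : Submodule Aᵐᵒᵖ A} (h : J ≤ K) :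
    rightIdealSMul J M ≤ rightIdealSMul K M :=
  AddSubgroup.closure_mono fun _ ⟨r, hr, m, hm⟩ => ⟨r, h hr, m, hm⟩

/-- Negation and zero need no cases of their own, since `-(r • m) = r • (-m)` and `0 = 0 • 0`. -/
theorem rightIdealSMul_induction {J : Submodule Aᵐᵒᵖ A} {p : M → Prop}
    (smul : ∀ r ∈ J, ∀ m : M, p (r • m)) (add : ∀ x y, p x → p y → p (x + y))
    {x : M} (hx : x ∈ rightIdealSMul J M) : p x := by
  refine AddSubgroup.closure_induction (p := fun x _ => p x ∧ p (-x)) ?_ ?_ ?_ ?_ hx |>.1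
  · rintro _ ⟨r, hr, m, rfl⟩
    exact ⟨smul r hr m, by simpa using smul r hr (-m)⟩
  · have := smul 0 J.zero_mem 0
    simpa using this
  · rintro x y - - ⟨hx, hx'⟩ ⟨hy, hy'⟩
    exact ⟨add _ _ hx hy, by rw [neg_add]; exact add _ _ hx' hy'⟩
  · rintro x - ⟨hx, hx'⟩
    exact ⟨hx', by rwa [neg_neg]⟩

theorem map_mem_rightIdealSMul {J : Submodule Aᵐᵒᵖ A} (f : M →ₗ[A] N) {x : M}
    (hx : x ∈ rightIdealSMul J M) : f x ∈ rightIdealSMul J N := by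
  refine rightIdealSMul_induction (p := fun x => f x ∈ rightIdealSMul J N) (fun r hr m => ?_)
    (fun x y hx hy => ?_) hx
  · rw [map_smul]
    exact smul_mem_rightIdealSMul hr _
  · rw [map_add]
    exact add_mem hx hy

theorem exists_add_of_mem_rightIdealSMul_sup {J K : Submodule Aᵐᵒᵖ A} {x : M}
    (hx : x ∈ rightIdealSMul (J ⊔ K) M) :
    ∃ y ∈ rightIdealSMul J M, ∃ z ∈ rightIdealSMul K M, y + z = x := by
  refine rightIdealSMul_induction
    (p := fun x => ∃ y ∈ rightIdealSMul J M, ∃ z ∈ rightIdealSMul K M, y + z = x)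
    (fun r hr m => ?_) (fun x y hx hy => ?_) hx
  · obtain ⟨a, ha, b, hb, rfl⟩ := Submodule.mem_sup.1 hr
    exact ⟨a • m, smul_mem_rightIdealSMul ha m, b • m, smul_mem_rightIdealSMul hb m,
      (add_smul a b m).symm⟩
  · obtain ⟨a, ha, b, hb, rfl⟩ := hx
    obtain ⟨c, hc, d, hd, rfl⟩ := hy
    exact ⟨a + c, add_mem ha hc, b + d, add_mem hb hd, add_add_add_comm a c b d⟩

/-- For a projective module, `J M ∩ K M = (J ∩ K) M`. -/
theorem mem_rightIdealSMul_inf [Module.Projective A M] {J K : Submodule Aᵐᵒᵖ A} {x : M}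
    (hJ : x ∈ rightIdealSMul J M) (hK : x ∈ rightIdealSMul K M) :
    x ∈ rightIdealSMul (J ⊓ K) M := by
  -- `σ` embeds `M` into the free module on the set `M`, as a section of the evaluation map. Since
  -- `L` is a right ideal, all coordinates of an element of `L M` lie in `L`. In coordinates the
  -- intersection is clear, and `σ` followed by evaluation recovers `x`.
  obtain ⟨σ, hσ⟩ := (Module.projective_def (R := A) (P := M)).1 inferInstance
  have key : ∀ {L : Submodule Aᵐᵒᵖ A} {x : M}, x ∈ rightIdealSMul L M → ∀ p, σ x p ∈ L := by
    intro L x hx p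
    refine rightIdealSMul_induction (p := fun x => σ x p ∈ L) (fun r hr m => ?_)
      (fun x y hx hy => ?_) hx
    · rw [map_smul, Finsupp.smul_apply, smul_eq_mul]
      exact L.smul_mem (MulOpposite.op (σ m p)) hr
    · rw [map_add, Finsupp.add_apply]
      exact add_mem hx hy
  rw [← hσ x, Finsupp.linearCombination_apply]
  exact sum_mem fun p _ => smul_mem_rightIdealSMul (Submodule.mem_inf.2 ⟨key hJ p, key hK p⟩) _

variable {ι : Type*} (E : ι → Submodule Aᵐᵒᵖ A)

/-- The sum of the right ideals `E i`, for `i` in a list. -/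
def listSup : List ι → Submodule Aᵐᵒᵖ A
  | [] => ⊥
  | i :: l => E i ⊔ listSup l

theorem le_listSup {l : List ι} {i : ι} (hi : i ∈ l) : E i ≤ listSup E l := by
  induction l with
  | nil => simp at hi
  | cons j l ih =>
    rcases List.mem_cons.1 hi with rfl | hi
    · exact le_sup_left
    · exact (ih hi).trans le_sup_right

theorem listSup_le {l : List ι} {J : Submodule Aᵐᵒᵖ A} (h : ∀ i ∈ l, E i ≤ J) :
    listSup E l ≤ J := by
  induction l with
  | nil => exact bot_le
  | cons j l ih =>
    exact sup_le (h j List.mem_cons_self) (ih fun i hi => h i (List.mem_cons_of_mem _ hi))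

theorem listSup_mono {l l' : List ι} (h : l ⊆ l') : listSup E l ≤ listSup E l' :=
  listSup_le E fun _ hi => le_listSup E (h hi)

/-- Let `E i` be right ideals generated by left identities, closed under intersections that
distribute over finite sums, and let `X` be an exact complex of modules that are projective in
positive degrees. If the `E i` kill `X 0`, then the subcomplexes `(∑ E i) X` are exact. -/
theorem listSup_exact (inter : ι → ι → ι) (hinter : ∀ i j, E (inter i j) = E i ⊓ E j)
    (hdistrib : ∀ l j, listSup E l ⊓ E j ≤ listSup E (l.map fun i => inter i j))
    (hunit : ∀ i, ∃ e ∈ E i, ∀ r ∈ E i, e * r = r)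
    (X : ℕ → Type u) [∀ q, AddCommGroup (X q)] [∀ q, Module A (X q)]
    [∀ q, Module.Projective A (X (q + 1))] (d : ∀ q, X (q + 1) →ₗ[A] X q)
    (hd : ∀ q x, d q (d (q + 1) x) = 0) (hex : ∀ q x, d q x = 0 → ∃ y, d (q + 1) y = x)
    (hX : ∀ i, ∀ r ∈ E i, ∀ x : X 0, r • x = 0)
    (l : List ι) (q : ℕ) (x : X (q + 1)) (hx : x ∈ rightIdealSMul (listSup E l) (X (q + 1)))
    (hdx : d q x = 0) : ∃ y ∈ rightIdealSMul (listSup E l) (X (q + 2)), d (q + 1) y = x := by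
  have hX0 : ∀ (l : List ι) (x : X 0), x ∈ rightIdealSMul (listSup E l) (X 0) → x = 0 := by
    intro l x hx
    refine rightIdealSMul_induction (p := fun x => x = 0) (fun r hr m => ?_)
      (fun x y hx hy => by rw [hx, hy, add_zero]) hx
    have : r ∈ LinearMap.ker (LinearMap.toSpanSingleton A (X 0) m) := by
      clear hx hdx
      induction l generalizing r with
      | nil =>
        rw [(Submodule.mem_bot _).1 hr]
        exact zero_mem _
      | cons i l ih =>
        obtain ⟨a, ha, b, hb, rfl⟩ := Submodule.mem_sup.1 hr
        exact add_mem (by simpa using hX i a ha m) (ih b hb)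
    simpa using this
  -- The induction is on the length because the hypothesis is applied both to the tail `l` and to
  -- the list of its intersections with `j`, which is a different list of the same length.
  induction hn : l.length generalizing l q x with
  | zero =>
    obtain rfl := List.length_eq_zero_iff.1 hn
    refine ⟨0, zero_mem _, ?_⟩
    rw [map_zero]
    refine (rightIdealSMul_induction (p := fun x => x = 0) (fun r hr m => ?_)
      (fun x y hx hy => by rw [hx, hy, add_zero]) hx).symm
    rw [(Submodule.mem_bot _).1 hr, zero_smul]
  | succ n ih =>
    obtain ⟨j, l, rfl⟩ := List.exists_cons_of_length_eq_add_one hn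
    have hl : l.length = n := by simpa using hn
    obtain ⟨a, ha, b, hb, rfl⟩ := exists_add_of_mem_rightIdealSMul_sup hx
    have hab : d q a = -d q b := eq_neg_of_add_eq_zero_left (by rw [← map_add, hdx])
    have hda : d q a ∈ rightIdealSMul (E j) (X q) := map_mem_rightIdealSMul _ ha
    have hdb : d q b ∈ rightIdealSMul (listSup E l) (X q) := map_mem_rightIdealSMul _ hb
    have hda' : d q b ∈ rightIdealSMul (E j) (X q) := by
      have := neg_mem hda
      rwa [hab, neg_neg] at this
    -- The connecting map of Mayer-Vietoris: `d b = -d a` is a cycle in the intersection of the two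
    -- subcomplexes, one degree lower. At `q = 0` it vanishes because the ideals kill `X 0`;
    -- otherwise `X (q + 1)` is projective, so that it lies in `(listSup E l ⊓ E j) X`, and
    -- distributivity makes this accessible to induction.
    obtain ⟨z, hz, hdz⟩ : ∃ z ∈ rightIdealSMul (listSup E l ⊓ E j) (X (q + 1)),
        d q z = d q b := by
      cases q with
      | zero => exact ⟨0, zero_mem _, by rw [map_zero, hX0 _ _ hdb]⟩
      | succ q =>
        have h1 := rightIdealSMul_mono (hdistrib l j) (mem_rightIdealSMul_inf hdb hda')
        obtain ⟨z, hz, h⟩ := ih _ q _ h1 (hd q b) (by simpa using hl)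
        refine ⟨z, rightIdealSMul_mono ?_ hz, h⟩
        refine listSup_le E fun i hi => ?_
        obtain ⟨i', hi', rfl⟩ := List.mem_map.1 hi
        rw [hinter]
        exact inf_le_inf_right _ (le_listSup E hi')
    obtain ⟨y, hy, hdy⟩ := ih l q (b - z) (sub_mem hb (rightIdealSMul_mono inf_le_left hz))
      (by rw [map_sub, hdz, sub_self]) hl
    have haz : a + z ∈ rightIdealSMul (E j) (X (q + 1)) :=
      add_mem ha (rightIdealSMul_mono inf_le_right hz)
    -- The correction by `z` splits `x` into the cycles `a + z` and `b - z`. The first one bounds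
    -- some `w` in `X`; multiplying `w` by the left identity moves it into `E j X` without changing
    -- its boundary.
    obtain ⟨w, hw⟩ := hex q (a + z) (by rw [map_add, hdz, hab, neg_add_cancel])
    obtain ⟨e, he, her⟩ := hunit j
    have hez : e • (a + z) = a + z := by
      refine rightIdealSMul_induction (p := fun x => e • x = x) (fun r hr m => ?_)
        (fun x y hx hy => by rw [smul_add, hx, hy]) haz
      rw [smul_smul, her r hr]
    refine ⟨e • w + y, add_mem (rightIdealSMul_mono le_sup_left (smul_mem_rightIdealSMul he w))
      (rightIdealSMul_mono le_sup_right hy), ?_⟩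
    rw [map_add, map_smul, hw, hez, hdy]
    abel

end MayerVietoris

/-! ### The universal property of `𝟙 ⊗_A M`: semilinear maps over the augmentation -/

section TrivialTensor

open CategoryTheory TensorProduct

variable {k A : Type u} [CommRing k] [Ring A] [Algebra k A] (ε : A →ₐ[k] k)

/-- The functor `N ↦ 𝟙 ⊗_A N`, where `𝟙` is the trivial right module of an augmented algebra. -/
noncomputable abbrev trivialTensor : ModuleCat.{u} A ⥤ ModuleCat.{u} k :=
  balancedTensorFunctor k A (TrivialModule ε)

namespace trivialTensor

section Quotient

variable (M : Type u) [AddCommGroup M] [Module k M] [Module A M]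

/-- The generator of the trivial module. -/
def one : TrivialModule ε := (1 : k)

theorem op_smul_one (a : A) : MulOpposite.op a • one ε = ε a • one ε := rfl

/-- The universal `ε`-semilinear map `x ↦ 1 ⊗ x`. -/
noncomputable def quotientMk : M →ₛₗ[(ε : A →+* k)]
    (TrivialModule ε ⊗[k] M) ⧸ BalancedTensor.relations k A (TrivialModule ε) M where
  toFun x := Submodule.Quotient.mk (one ε ⊗ₜ[k] x)
  map_add' x y := by rw [TensorProduct.tmul_add]; rfl
  map_smul' a x := by
    have h : (ε a • one ε ⊗ₜ[k] x) - one ε ⊗ₜ[k] (a • x) ∈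
        BalancedTensor.relations k A (TrivialModule ε) M :=
      Submodule.subset_span ⟨one ε, a, x, by rw [op_smul_one, TensorProduct.smul_tmul']⟩
    exact ((Submodule.Quotient.eq _).2 h).symm

variable {M} {N : Type u} [AddCommGroup N] [Module k N]

/-- The linear map induced by an `ε`-semilinear map. -/
noncomputable def quotientLift [IsScalarTower k A M] (h : M →ₛₗ[(ε : A →+* k)] N) :
    (TrivialModule ε ⊗[k] M) ⧸ BalancedTensor.relations k A (TrivialModule ε) M →ₗ[k] N :=
  Submodule.liftQ _ (TensorProduct.lift (LinearMap.mk₂ k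
      (fun (c : TrivialModule ε) (x : M) => (id c : k) • h x)
      (fun c c' x => add_smul (R := k) c c' (h x))
      (fun r c x => mul_smul (α := k) r c (h x))
      (fun c x y => by rw [map_add, smul_add])
      (fun r c x => by
        rw [← algebraMap_smul A r x, h.map_smulₛₗ, smul_comm]
        congr 1
        exact ε.commutes r))) (by
    rw [Submodule.span_le]
    rintro _ ⟨m, a, x, rfl⟩
    rw [SetLike.mem_coe, LinearMap.mem_ker, map_sub, TensorProduct.lift.tmul,
      TensorProduct.lift.tmul, sub_eq_zero]
    exact (mul_smul (α := k) (ε a) m (h x)).trans ((smul_comm (ε a) (id m : k) (h x)).trans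
      (congrArg (fun y => (id m : k) • y) (h.map_smulₛₗ a x).symm)))

theorem quotientLift_mk [IsScalarTower k A M] (h : M →ₛₗ[(ε : A →+* k)] N) (x : M) :
    quotientLift ε h (quotientMk ε M x) = h x :=
  one_smul k (h x)

/-- Every pure tensor is `c ⊗ x = c • (1 ⊗ x)`, so the elements `1 ⊗ x` generate over `k`. -/
theorem quotient_hom_ext
    {f g : (TrivialModule ε ⊗[k] M) ⧸ BalancedTensor.relations k A (TrivialModule ε) M →ₗ[k] N}
    (h : ∀ x, f (quotientMk ε M x) = g (quotientMk ε M x)) : f = g := by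
  refine Submodule.linearMap_qext _ (TensorProduct.ext' fun c x => ?_)
  have hc : c ⊗ₜ[k] x = (id c : k) • (one ε ⊗ₜ[k] x) := by
    rw [TensorProduct.smul_tmul']
    congr 1
    exact (mul_one (id c : k)).symm
  rw [hc, map_smul, map_smul]
  exact congrArg _ (h x)

end Quotient

/-- A module over an algebra as a module over the base ring. -/
theorem isScalarTower_compHom (M : ModuleCat.{u} A) :
    letI : Module k M := Module.compHom M (algebraMap k A)
    IsScalarTower k A M :=
  let _ : Module k M := Module.compHom M (algebraMap k A)
  ⟨fun r a x => by rw [Algebra.smul_def, mul_smul]; rfl⟩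

/-- The universal `ε`-semilinear map `x ↦ 1 ⊗ x`. -/
noncomputable def mk (M : ModuleCat.{u} A) : M →ₛₗ[(ε : A →+* k)] (trivialTensor ε).obj M :=
  letI : Module k M := Module.compHom M (algebraMap k A)
  quotientMk ε M

variable {ε} in
/-- The linear map induced by an `ε`-semilinear map. -/
noncomputable def lift {M : ModuleCat.{u} A} {N : Type u} [AddCommGroup N] [Module k N]
    (h : M →ₛₗ[(ε : A →+* k)] N) : (trivialTensor ε).obj M →ₗ[k] N :=
  letI : Module k M := Module.compHom M (algebraMap k A)
  haveI := isScalarTower_compHom (k := k) M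
  quotientLift ε h

theorem lift_mk {M : ModuleCat.{u} A} {N : Type u} [AddCommGroup N] [Module k N]
    (h : M →ₛₗ[(ε : A →+* k)] N) (x : M) : lift h (mk ε M x) = h x :=
  let _ : Module k M := Module.compHom M (algebraMap k A)
  have := isScalarTower_compHom (k := k) M
  quotientLift_mk ε h x

theorem hom_ext {M : ModuleCat.{u} A} {N : Type u} [AddCommGroup N] [Module k N]
    {f g : (trivialTensor ε).obj M →ₗ[k] N} (h : ∀ x, f (mk ε M x) = g (mk ε M x)) : f = g :=
  let _ : Module k M := Module.compHom M (algebraMap k A)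
  quotient_hom_ext ε h

end trivialTensor

/-- A resolution of the trivial module computes `Tor^A(𝟙, 𝟙)`. -/
noncomputable def trivialTorIso (P : ProjectiveResolution (ModuleCat.of A (TrivialModule ε)))
    (q : ℕ) : trivialTor ε q ≅
      (((trivialTensor ε).mapHomologicalComplex _).obj P.complex).homology q :=
  P.isoLeftDerivedObj _ q

end TrivialTensor

/-! ### Projective resolutions from elementwise exactness -/

section Resolution

open CategoryTheory Limits

variable {A : Type u} [Ring A]

/-- A complex of projective modules with an augmentation, exact on the level of elements, is a
projective resolution. -/
noncomputable def projectiveResolutionOfExact {Z : ModuleCat.{u} A}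
    (C : ChainComplex (ModuleCat.{u} A) ℕ)
    (hC : ∀ q, Projective (C.X q)) (p : C.X 0 ⟶ Z) (hp : C.d 1 0 ≫ p = 0)
    (hsurj : Function.Surjective p.hom)
    (h0 : ∀ x : C.X 0, p.hom x = 0 → ∃ y, (C.d 1 0).hom y = x)
    (hex : ∀ q, ∀ x : C.X (q + 1), (C.d (q + 1) q).hom x = 0 →
      ∃ y, (C.d (q + 2) (q + 1)).hom y = x) :
    ProjectiveResolution Z where
  complex := C
  projective := hC
  π := (C.toSingle₀Equiv Z).symm ⟨p, hp⟩
  quasiIso := ⟨fun n => by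
    cases n
    -- In degree `0` a quasi-isomorphism to `Z` amounts to exactness of `C₁ → C₀ → Z` together with
    -- surjectivity of `p`.
    · rw [ChainComplex.quasiIsoAt₀_iff, ShortComplex.quasiIso_iff_of_zeros']
      · have hE : (ShortComplex.mk (C.d 1 0) p hp).Exact :=
          (ShortComplex.moduleCat_exact_iff _).2 h0
        refine (ShortComplex.exact_and_epi_g_iff_of_iso ?_).2
          ⟨hE, (ModuleCat.epi_iff_surjective p).2 hsurj⟩
        exact ShortComplex.isoMk (Iso.refl _) (Iso.refl _) (Iso.refl _)
          ((Category.id_comp _).trans (Category.comp_id _).symm)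
          ((Category.id_comp _).trans (Category.comp_id _).symm)
      · exact C.shape _ _ (by simp)
      all_goals rfl
    · rename_i n
      -- The target is concentrated in degree `0`, so in positive degrees only exactness of `C` is
      -- at stake.
      rw [quasiIsoAt_iff_exactAt']
      · rw [HomologicalComplex.exactAt_iff' _ (n + 1 + 1) (n + 1) n (by simp) (by simp)]
        exact (ShortComplex.moduleCat_exact_iff _).2 (hex n)
      · apply ChainComplex.exactAt_succ_single_obj⟩

end Resolution

/-! ### Reduction of modules modulo the kernel of a split surjection -/

section Reduction

open CategoryTheory Limits

variable {A B : Type u} [Ring A] [Ring B] (φ : A →+* B) (s : B →+* A)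

/-- The submodule `I M` of a module `M`, where `I` is the kernel of `φ`. -/
abbrev kerSMul (M : Type u) [AddCommGroup M] [Module A M] : Submodule A M :=
  RingHom.ker φ • ⊤

theorem kerSMul_le {M N : Type u} [AddCommGroup M] [Module A M] [AddCommGroup N] [Module A N]
    (f : M →ₗ[A] N) : kerSMul φ M ≤ (kerSMul φ N).comap f :=
  Submodule.smul_le.2 fun r hr m _ => by
    rw [Submodule.mem_comap, map_smul]
    exact Submodule.smul_mem_smul hr trivial

/-- The module `M / I M` over `B`, where `I` is the kernel of `φ : A → B` and `B` acts through
`s : B → A`. -/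
def Reduction (_s : B →+* A) (M : Type u) [AddCommGroup M] [Module A M] : Type u :=
  M ⧸ kerSMul φ M

namespace Reduction

variable (M : Type u) [AddCommGroup M] [Module A M]

instance : AddCommGroup (Reduction φ s M) := inferInstanceAs (AddCommGroup (M ⧸ kerSMul φ M))

instance : Module B (Reduction φ s M) := Module.compHom (M ⧸ kerSMul φ M) s

/-- The projection `M → M / I M`. -/
def mk : M →+ Reduction φ s M := (kerSMul φ M).mkQ.toAddMonoidHom

variable {M}

theorem mk_surjective : Function.Surjective (mk φ s M) :=
  Submodule.mkQ_surjective _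

theorem smul_mk (b : B) (x : M) : b • mk φ s M x = mk φ s M (s b • x) := rfl

theorem mk_eq_zero {x : M} : mk φ s M x = 0 ↔ x ∈ kerSMul φ M :=
  Submodule.Quotient.mk_eq_zero _

/-- The elements `a` and `s (φ a)` differ by an element of the kernel `I`, which acts as zero on `M
/ I M`. Hence the `B`-action defined through `s` is the one induced by `A / I ≅ B`. -/
theorem mk_smul (hs : ∀ b, φ (s b) = b) (a : A) (x : M) :
    mk φ s M (a • x) = φ a • mk φ s M x := by
  rw [smul_mk, ← sub_eq_zero, ← map_sub, mk_eq_zero, ← sub_smul]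
  exact Submodule.smul_mem_smul (by rw [RingHom.mem_ker, map_sub, hs, sub_self]) trivial

variable {N : Type u} [AddCommGroup N]

/-- The map on `M / I M` induced by an additive map that kills `I M`. -/
def lift (h : M →+ N) (hI : ∀ a, φ a = 0 → ∀ x, h (a • x) = 0) : Reduction φ s M →+ N :=
  QuotientAddGroup.lift (kerSMul φ M).toAddSubgroup h fun x hx =>
    Submodule.smul_induction_on (p := fun x => h x = 0) hx
      (fun r hr m _ => hI r hr m) fun x y hx hy => by rw [map_add, hx, hy, add_zero]

variable [Module A N]

/-- The functoriality of `M ↦ M / I M`. -/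
def map (f : M →ₗ[A] N) : Reduction φ s M →ₗ[B] Reduction φ s N where
  toFun := Submodule.mapQ _ _ f (kerSMul_le φ f)
  map_add' := map_add _
  map_smul' b x := by
    obtain ⟨x, rfl⟩ := mk_surjective φ s x
    exact congrArg (mk φ s N) (map_smul f (s b) x)

end Reduction

/-- The functor `M ↦ M / I M`. -/
def reduction : ModuleCat.{u} A ⥤ ModuleCat.{u} B where
  obj M := ModuleCat.of B (Reduction φ s M)
  map f := ModuleCat.ofHom (Reduction.map φ s f.hom)
  map_id M := by
    ext x
    obtain ⟨x, rfl⟩ := Reduction.mk_surjective φ s x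
    rfl
  map_comp f g := by
    ext x
    obtain ⟨x, rfl⟩ := Reduction.mk_surjective φ s x
    rfl

instance : (reduction φ s).Additive where
  map_add {M N f g} := by
    ext x
    obtain ⟨x, rfl⟩ := Reduction.mk_surjective φ s x
    rfl

/-- `M ↦ M / I M` is left adjoint to restriction along `φ`, which preserves surjections. A lifting
problem over `B` is restricted to `A` and solved on `M`. -/
theorem reduction_projective (hs : ∀ b, φ (s b) = b) (M : ModuleCat.{u} A) [Projective M] :
    Projective ((reduction φ s).obj M) where
  factors {X Y} f e he := by
    let _ : Module A X := Module.compHom X φ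
    let _ : Module A Y := Module.compHom Y φ
    have : Module.Projective A M := (IsProjective.iff_projective (R := A) M).2 inferInstance
    let e' : X →ₗ[A] Y :=
      { toFun := e.hom, map_add' := map_add _, map_smul' := fun a x => map_smul e.hom (φ a) x }
    let f' : M →ₗ[A] Y :=
      { toFun := fun x => f.hom (Reduction.mk φ s M x)
        map_add' := fun x y => (congrArg f.hom (map_add (Reduction.mk φ s M) x y)).trans
          (map_add f.hom _ _)
        map_smul' := fun a x => by
          rw [Reduction.mk_smul φ s hs]
          exact map_smul f.hom _ _ }
    obtain ⟨g, hg⟩ := Module.projective_lifting_property e' f'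
      ((ModuleCat.epi_iff_surjective e).1 he)
    -- The lift descends to `M / I M` because `I` acts as zero on a module restricted along `φ`.
    have hgI : ∀ a, φ a = 0 → ∀ x, g.toAddMonoidHom (a • x) = 0 := fun a ha x => by
      refine (map_smul g a x).trans ?_
      change φ a • g x = 0
      rw [ha, zero_smul]
    let g' : Reduction φ s M →ₗ[B] X :=
      { toFun := Reduction.lift φ s g.toAddMonoidHom hgI
        map_add' := map_add _
        map_smul' := fun b x => by
          obtain ⟨x, rfl⟩ := Reduction.mk_surjective φ s x
          refine (map_smul g (s b) x).trans ?_
          change φ (s b) • g x = b • g x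
          rw [hs] }
    refine ⟨ModuleCat.ofHom g', ?_⟩
    ext x
    obtain ⟨x, rfl⟩ := Reduction.mk_surjective φ s x
    exact LinearMap.congr_fun hg x

end Reduction

/-! ### Comparison of Tor over `A` and over `B` -/

section Comparison

open CategoryTheory Limits

variable {k A B : Type u} [CommRing k] [Ring A] [Algebra k A] [Ring B] [Algebra k B]
  (φ : A →+* B) (s : B →+* A) (ε : A →ₐ[k] k) (ε' : B →ₐ[k] k)

/-- The comparison map `𝟙 ⊗_A M → 𝟙 ⊗_B M / I M`. -/
noncomputable def tensorToReduction (hs : ∀ b, φ (s b) = b) (hε : ∀ a, ε' (φ a) = ε a)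
    (M : ModuleCat.{u} A) :
    (trivialTensor ε).obj M →ₗ[k] (trivialTensor ε').obj ((reduction φ s).obj M) :=
  trivialTensor.lift
    { toFun := fun x => trivialTensor.mk ε' ((reduction φ s).obj M) (Reduction.mk φ s M x)
      map_add' := fun x y => by
        rw [map_add]
        exact map_add (trivialTensor.mk ε' ((reduction φ s).obj M)) _ _
      map_smul' := fun a x => by
        rw [Reduction.mk_smul φ s hs]
        refine (LinearMap.map_smulₛₗ (trivialTensor.mk ε' ((reduction φ s).obj M)) _ _).trans ?_
        exact congrArg (fun r : k => r • trivialTensor.mk ε' ((reduction φ s).obj M)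
          (Reduction.mk φ s M x)) (hε a) }

/-- The comparison map `𝟙 ⊗_B M / I M → 𝟙 ⊗_A M`. -/
noncomputable def reductionToTensor (hs : ∀ b, φ (s b) = b) (hε : ∀ a, ε' (φ a) = ε a)
    (M : ModuleCat.{u} A) :
    (trivialTensor ε').obj ((reduction φ s).obj M) →ₗ[k] (trivialTensor ε).obj M :=
  trivialTensor.lift (M := (reduction φ s).obj M)
    -- For `φ a = 0` the scalar `ε a = ε' (φ a)` is zero, so `1 ⊗ a x = ε a • (1 ⊗ x)` vanishes.
    { toFun := Reduction.lift φ s (trivialTensor.mk ε M).toAddMonoidHom fun a ha x => by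
        refine ((trivialTensor.mk ε M).map_smulₛₗ a x).trans ?_
        change ε a • _ = _
        rw [← hε, ha, map_zero, zero_smul]
      map_add' := map_add _
      map_smul' := fun b x => by
        obtain ⟨x, rfl⟩ := Reduction.mk_surjective φ s x
        refine ((trivialTensor.mk ε M).map_smulₛₗ (s b) x).trans ?_
        change ε (s b) • _ = ε' b • _
        rw [← hε, hs]
        rfl }

theorem tensorToReduction_mk (hs : ∀ b, φ (s b) = b) (hε : ∀ a, ε' (φ a) = ε a)
    (M : ModuleCat.{u} A) (x : M) :
    tensorToReduction φ s ε ε' hs hε M (trivialTensor.mk ε M x) =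
      trivialTensor.mk ε' ((reduction φ s).obj M) (Reduction.mk φ s M x) :=
  trivialTensor.lift_mk ..

theorem reductionToTensor_mk (hs : ∀ b, φ (s b) = b) (hε : ∀ a, ε' (φ a) = ε a)
    (M : ModuleCat.{u} A) (x : M) :
    reductionToTensor φ s ε ε' hs hε M
      (trivialTensor.mk ε' ((reduction φ s).obj M) (Reduction.mk φ s M x)) =
      trivialTensor.mk ε M x :=
  trivialTensor.lift_mk ..

/-- `𝟙 ⊗_A M = 𝟙 ⊗_B M / I M`. -/
noncomputable def trivialTensorIsoReduction (hs : ∀ b, φ (s b) = b)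
    (hε : ∀ a, ε' (φ a) = ε a) :
    trivialTensor ε ≅ reduction φ s ⋙ trivialTensor ε' :=
  NatIso.ofComponents (fun M => LinearEquiv.toModuleIso
    (LinearEquiv.ofLinearMap (tensorToReduction φ s ε ε' hs hε M)
      (reductionToTensor φ s ε ε' hs hε M)
      (trivialTensor.hom_ext ε' fun x => by
        obtain ⟨x, rfl⟩ := Reduction.mk_surjective φ s x
        exact (congrArg (tensorToReduction φ s ε ε' hs hε M)
          (reductionToTensor_mk φ s ε ε' hs hε M x)).trans
          (tensorToReduction_mk φ s ε ε' hs hε M x))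
      (trivialTensor.hom_ext ε fun x =>
        (congrArg (reductionToTensor φ s ε ε' hs hε M)
          (tensorToReduction_mk φ s ε ε' hs hε M x)).trans
          (reductionToTensor_mk φ s ε ε' hs hε M x))))
    fun {M N} f => by
      apply ModuleCat.hom_ext
      refine trivialTensor.hom_ext ε fun x => ?_
      exact (tensorToReduction_mk φ s ε ε' hs hε N (f.hom x)).trans
        (congrArg ((trivialTensor ε').map ((reduction φ s).map f)).hom
          (tensorToReduction_mk φ s ε ε' hs hε M x).symm)

theorem exact_zero_of_projectiveResolution {Z : ModuleCat.{u} A} (P : ProjectiveResolution Z)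
    (x : P.complex.X 0) (hx : (P.π.f 0).hom x = 0) : ∃ y, (P.complex.d 1 0).hom y = x :=
  (ShortComplex.moduleCat_exact_iff _).1 P.exact₀ x hx

theorem exact_succ_of_projectiveResolution {Z : ModuleCat.{u} A} (P : ProjectiveResolution Z)
    (q : ℕ) (x : P.complex.X (q + 1)) (hx : (P.complex.d (q + 1) q).hom x = 0) :
    ∃ y, (P.complex.d (q + 2) (q + 1)).hom y = x :=
  (ShortComplex.moduleCat_exact_iff _).1 (P.exact_succ q) x hx

/-- The augmentation `P₀ → 𝟙`. -/
noncomputable def augmentationMap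
    (P : ProjectiveResolution (ModuleCat.of A (TrivialModule ε))) :
    P.complex.X 0 →ₗ[A] TrivialModule ε :=
  (P.π.f 0).hom

/-- The augmentation `P₀ / I P₀ → 𝟙`. -/
noncomputable def reductionAugmentation (hs : ∀ b, φ (s b) = b) (hε : ∀ a, ε' (φ a) = ε a)
    (P : ProjectiveResolution (ModuleCat.of A (TrivialModule ε))) :
    (reduction φ s).obj (P.complex.X 0) ⟶ ModuleCat.of B (TrivialModule ε') :=
  ModuleCat.ofHom (X := Reduction φ s (P.complex.X 0))
    { toFun := Reduction.lift φ s (N := TrivialModule ε') (augmentationMap ε P).toAddMonoidHom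
        fun a ha x => by
          refine (map_smul (augmentationMap ε P) a x).trans ?_
          change ε a * (id (augmentationMap ε P x) : k) = 0
          rw [← hε, ha, map_zero, zero_mul]
      map_add' := map_add _
      map_smul' := fun b x => by
        obtain ⟨x, rfl⟩ := Reduction.mk_surjective φ s x
        refine (map_smul (augmentationMap ε P) (s b) x).trans ?_
        change ε (s b) * (id (augmentationMap ε P x) : k) =
          ε' b * (id (augmentationMap ε P x) : k)
        rw [← hε, hs] }

/-- If `I P` is exact, then `P / I P` is a projective resolution of the trivial module. -/
noncomputable def reductionResolution (hs : ∀ b, φ (s b) = b) (hε : ∀ a, ε' (φ a) = ε a)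
    (P : ProjectiveResolution (ModuleCat.of A (TrivialModule ε)))
    (h0 : ∀ x ∈ kerSMul φ (P.complex.X 0), ∃ y ∈ kerSMul φ (P.complex.X 1),
      (P.complex.d 1 0).hom y = x)
    (hI : ∀ q, ∀ x ∈ kerSMul φ (P.complex.X (q + 1)), (P.complex.d (q + 1) q).hom x = 0 →
      ∃ y ∈ kerSMul φ (P.complex.X (q + 2)), (P.complex.d (q + 2) (q + 1)).hom y = x) :
    ProjectiveResolution (ModuleCat.of B (TrivialModule ε')) :=
  projectiveResolutionOfExact (((reduction φ s).mapHomologicalComplex _).obj P.complex)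
    (fun q => reduction_projective φ s hs (P.complex.X q))
    (reductionAugmentation φ s ε ε' hs hε P)
    (by
      ext x
      obtain ⟨x, rfl⟩ := Reduction.mk_surjective φ s x
      exact LinearMap.congr_fun (congrArg ModuleCat.Hom.hom P.complex_d_comp_π_f_zero) x)
    (fun z => by
      obtain ⟨x, hx⟩ := (ModuleCat.epi_iff_surjective (P.π.f 0)).1 inferInstance z
      exact ⟨Reduction.mk φ s _ x, hx⟩)
    (fun x hx => by
      obtain ⟨x, rfl⟩ := Reduction.mk_surjective φ s x
      obtain ⟨y, rfl⟩ := exact_zero_of_projectiveResolution P x hx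
      exact ⟨Reduction.mk φ s _ y, rfl⟩)
    (fun q x hx => by
      obtain ⟨x, rfl⟩ := Reduction.mk_surjective φ s x
      have hx' : (P.complex.d (q + 1) q).hom x ∈ kerSMul φ (P.complex.X q) :=
        (Reduction.mk_eq_zero φ s).1 hx
      have hdd : ∀ p (y : P.complex.X (p + 2)),
          (P.complex.d (p + 1) p).hom ((P.complex.d (p + 2) (p + 1)).hom y) = 0 := fun p y =>
        LinearMap.congr_fun (congrArg ModuleCat.Hom.hom (P.complex.d_comp_d (p + 2) (p + 1) p)) y
      -- This is the long exact sequence of `I P → P → P / I P`, on elements: a lift `x` of a cycle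
      -- has boundary in `I P`, acyclicity of `I P` gives `y` in `I P` with the same boundary, and
      -- `x - y` is a cycle of `P` with the same class as `x` modulo `I P`. In the lowest degree
      -- `h0` asks for no cycle condition.
      obtain ⟨y, hy, hyx⟩ : ∃ y ∈ kerSMul φ (P.complex.X (q + 1)),
          (P.complex.d (q + 1) q).hom y = (P.complex.d (q + 1) q).hom x := by
        cases q with
        | zero => exact h0 _ hx'
        | succ q => exact hI q _ hx' (hdd q x)
      obtain ⟨z, hz⟩ := exact_succ_of_projectiveResolution P q (x - y)
        (by rw [map_sub, hyx, sub_self])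
      refine ⟨Reduction.mk φ s _ z, ?_⟩
      change Reduction.mk φ s _ ((P.complex.d (q + 2) (q + 1)).hom z) = _
      rw [hz, map_sub, (Reduction.mk_eq_zero φ s).2 hy, sub_zero])

/-- If `I P` is exact for a projective resolution `P` of the trivial `A`-module, then the
trivial modules have the same Tor over `A` and over `B = A / I`. -/
noncomputable def trivialTorReductionIso (hs : ∀ b, φ (s b) = b) (hε : ∀ a, ε' (φ a) = ε a)
    (P : ProjectiveResolution (ModuleCat.of A (TrivialModule ε)))
    (h0 : ∀ x ∈ kerSMul φ (P.complex.X 0), ∃ y ∈ kerSMul φ (P.complex.X 1),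
      (P.complex.d 1 0).hom y = x)
    (hI : ∀ q, ∀ x ∈ kerSMul φ (P.complex.X (q + 1)), (P.complex.d (q + 1) q).hom x = 0 →
      ∃ y ∈ kerSMul φ (P.complex.X (q + 2)), (P.complex.d (q + 2) (q + 1)).hom y = x)
    (q : ℕ) : trivialTor ε q ≅ trivialTor ε' q :=
  trivialTorIso ε P q ≪≫
    (HomologicalComplex.homologyFunctor _ _ q).mapIso
      ((NatIso.mapHomologicalComplex (trivialTensorIsoReduction φ s ε ε' hs hε) _).app P.complex) ≪≫
    (trivialTorIso ε' (reductionResolution φ s ε ε' hs hε P h0 hI) q).symm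

end Comparison

/-! ### Families of right ideals with left identities that sum to the kernel -/

section LeftIdentities

open CategoryTheory Limits

variable {k A B : Type u} [CommRing k] [Ring A] [Algebra k A] [Ring B] [Algebra k B]
  (φ : A →+* B) {ι : Type*} (E : ι → Submodule Aᵐᵒᵖ A)

/-- The family may be infinite, but an element of `I M` is a finite sum of products `r • m`, so that
concatenating the lists for the coefficients `r` suffices. This reduces acyclicity of `I P` to
finite sums of ideals. -/
theorem exists_list_of_mem_kerSMul (hE : ∀ r, φ r = 0 → ∃ l, r ∈ listSup E l)
    {M : Type u} [AddCommGroup M] [Module A M] {x : M} (hx : x ∈ kerSMul φ M) :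
    ∃ l, x ∈ rightIdealSMul (listSup E l) M := by
  refine Submodule.smul_induction_on (p := fun x => ∃ l, x ∈ rightIdealSMul (listSup E l) M) hx
    (fun r hr m _ => ?_) (fun x y hx hy => ?_)
  · obtain ⟨l, hl⟩ := hE r hr
    exact ⟨l, smul_mem_rightIdealSMul hl m⟩
  · obtain ⟨l, hl⟩ := hx
    obtain ⟨l', hl'⟩ := hy
    exact ⟨l ++ l', add_mem
      (rightIdealSMul_mono (listSup_mono E (List.subset_append_left l l')) hl)
      (rightIdealSMul_mono (listSup_mono E (List.subset_append_right l l')) hl')⟩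

theorem map_eq_zero_of_mem_listSup (hE : ∀ i, ∀ r ∈ E i, φ r = 0) {l : List ι} {r : A}
    (hr : r ∈ listSup E l) : φ r = 0 := by
  induction l generalizing r with
  | nil => rw [(Submodule.mem_bot _).1 hr, map_zero]
  | cons i l ih =>
    obtain ⟨a, ha, b, hb, rfl⟩ := Submodule.mem_sup.1 hr
    rw [map_add, hE i a ha, ih hb, add_zero]

theorem mem_kerSMul_of_mem_rightIdealSMul (hE : ∀ i, ∀ r ∈ E i, φ r = 0)
    {M : Type u} [AddCommGroup M] [Module A M] {l : List ι} {x : M}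
    (hx : x ∈ rightIdealSMul (listSup E l) M) : x ∈ kerSMul φ M :=
  rightIdealSMul_induction (p := fun x => x ∈ kerSMul φ M)
    (fun _ hr _ => Submodule.smul_mem_smul (map_eq_zero_of_mem_listSup φ E hE hr) trivial)
    (fun _ _ hx hy => add_mem hx hy) hx

/-- The objects of an augmented resolution. -/
noncomputable def augmentedX {Z : ModuleCat.{u} A} (P : ProjectiveResolution Z) :
    ℕ → ModuleCat.{u} A
  | 0 => Z
  | q + 1 => P.complex.X q

/-- The differentials of an augmented resolution. -/
noncomputable def augmentedD {Z : ModuleCat.{u} A} (P : ProjectiveResolution Z) :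
    ∀ q, augmentedX P (q + 1) →ₗ[A] augmentedX P q
  | 0 => (P.π.f 0).hom
  | q + 1 => (P.complex.d (q + 1) q).hom

/-- If the kernel of a split surjection `φ : A → B` is the sum of a family of right ideals with
left identities, closed under intersections that distribute over finite sums, then the trivial
modules have the same Tor over `A` and over `B`. -/
theorem nonempty_trivialTor_equiv (s : B →+* A) (ε : A →ₐ[k] k) (ε' : B →ₐ[k] k)
    (hs : ∀ b, φ (s b) = b) (hε : ∀ a, ε' (φ a) = ε a)
    (inter : ι → ι → ι) (hinter : ∀ i j, E (inter i j) = E i ⊓ E j)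
    (hdistrib : ∀ l j, listSup E l ⊓ E j ≤ listSup E (l.map fun i => inter i j))
    (hunit : ∀ i, ∃ e ∈ E i, ∀ r ∈ E i, e * r = r)
    (hker : ∀ i, ∀ r ∈ E i, φ r = 0) (hE : ∀ r, φ r = 0 → ∃ l, r ∈ listSup E l) :
    Nonempty (∀ q : ℕ, trivialTor ε q ≃ₗ[k] trivialTor ε' q) := by
  let P := projectiveResolution (ModuleCat.of A (TrivialModule ε))
  have : ∀ q, Module.Projective A (augmentedX P (q + 1)) := fun q =>
    (IsProjective.iff_projective (R := A) (P.complex.X q)).2 (P.projective q)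
  have hX : ∀ i, ∀ r ∈ E i, ∀ x : augmentedX P 0, r • x = 0 := by
    intro i r hr x
    change ε r * (id x : k) = 0
    rw [← hε, hker i r hr, map_zero, zero_mul]
  have hd : ∀ q x, augmentedD P q (augmentedD P (q + 1) x) = 0 := by
    rintro (_ | q) x
    · exact LinearMap.congr_fun (congrArg ModuleCat.Hom.hom P.complex_d_comp_π_f_zero) x
    · exact LinearMap.congr_fun
        (congrArg ModuleCat.Hom.hom (P.complex.d_comp_d (q + 2) (q + 1) q)) x
  have hex : ∀ q x, augmentedD P q x = 0 → ∃ y, augmentedD P (q + 1) y = x := by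
    rintro (_ | q) x hx
    · exact exact_zero_of_projectiveResolution P x hx
    · exact exact_succ_of_projectiveResolution P q x hx
  have key := listSup_exact E inter hinter hdistrib hunit (fun q => augmentedX P q) (augmentedD P)
    hd hex hX
  refine ⟨fun q => (trivialTorReductionIso φ s ε ε' hs hε P (fun x hx => ?_)
    (fun q x hx hdx => ?_) q).toLinearEquiv⟩
  · obtain ⟨l, hl⟩ := exists_list_of_mem_kerSMul φ E hE hx
    -- The index `0` of the augmented complex is `𝟙`, so `P_q` has index `q + 1` and this is
    -- exactness at `P_0`. Elements of `I P_0` are automatically cycles there, since `I` acts as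
    -- zero on `𝟙`.
    obtain ⟨y, hy, hyx⟩ := key l 0 x hl (by
      refine rightIdealSMul_induction (p := fun x => augmentedD P 0 x = 0) (fun r hr m => ?_)
        (fun x y hx hy => by rw [map_add, hx, hy, add_zero]) hl
      rw [map_smul]
      change ε r * (id (augmentedD P 0 m) : k) = 0
      rw [← hε, map_eq_zero_of_mem_listSup φ E hker hr, map_zero, zero_mul])
    exact ⟨y, mem_kerSMul_of_mem_rightIdealSMul φ E hker hy, hyx⟩
  · obtain ⟨l, hl⟩ := exists_list_of_mem_kerSMul φ E hE hx
    obtain ⟨y, hy, hyx⟩ := key l (q + 1) x hl hdx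
    exact ⟨y, mem_kerSMul_of_mem_rightIdealSMul φ E hker hy, hyx⟩

end LeftIdentities

/-! ### Tor over a group algebra as group homology -/

section GroupHomology

open CategoryTheory Limits MonoidalCategory TensorProduct

variable (k H : Type u) [CommRing k] [Group H]

instance : (Rep.toModuleMonoidAlgebra.{u} (k := k) (G := H)).Additive where
  map_add := rfl

theorem groupAugmentation_single (g : H) (r : k) :
    groupAugmentation k H (MonoidAlgebra.single g r) = r := by
  simp [groupAugmentation]

/-- `x ↦ 1 ⊗ x` is semilinear over the augmentation of the group algebra. -/
theorem coinvariantsTensorMk_smul (V : Rep.{u} k H) (a : MonoidAlgebra k H) (x : V.ρ.asModule) :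
    Rep.coinvariantsTensorMk (Rep.trivial k H k) V (1 : k) (V.ρ.asModuleEquiv (a • x)) =
      groupAugmentation k H a •
        Rep.coinvariantsTensorMk (Rep.trivial k H k) V (1 : k) (V.ρ.asModuleEquiv x) := by
  induction a using MonoidAlgebra.induction_linear with
  | zero => simp
  | add f g hf hg => rw [add_smul, map_add, map_add, hf, hg, map_add, add_smul]
  | single g r =>
    rw [groupAugmentation_single, Representation.asModuleEquiv_map_smul,
      Representation.asAlgebraHom_single, LinearMap.smul_apply, map_smul]
    congr 1
    -- Since `g` fixes `1` in the trivial representation, it carries `1 ⊗ x` to `1 ⊗ g x`, and the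
    -- two agree in the coinvariants.
    exact Representation.Coinvariants.mk_self_apply
      ((Rep.trivial k H k).ρ.tprod V.ρ) g ((1 : k) ⊗ₜ[k] V.ρ.asModuleEquiv x)

/-- The comparison map `𝟙 ⊗_{k[H]} V → (k ⊗ V)_H`. -/
noncomputable def tensorToCoinvariants (V : Rep.{u} k H) :
    (trivialTensor (groupAugmentation k H)).obj (Rep.toModuleMonoidAlgebra.obj V) →ₗ[k]
      ((Rep.coinvariantsTensor k H).obj (Rep.trivial k H k)).obj V :=
  trivialTensor.lift (M := Rep.toModuleMonoidAlgebra.obj V)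
    { toFun := fun x =>
        Rep.coinvariantsTensorMk (Rep.trivial k H k) V (1 : k) (V.ρ.asModuleEquiv x)
      map_add' := fun x y => by
        exact (congrArg _ (map_add V.ρ.asModuleEquiv x y)).trans (map_add _ _ _)
      map_smul' := coinvariantsTensorMk_smul k H V }

/-- The map `x ↦ 1 ⊗ x` on a representation. -/
noncomputable def repTensorMk (V : Rep.{u} k H) :
    V →ₗ[k] (trivialTensor (groupAugmentation k H)).obj (Rep.toModuleMonoidAlgebra.obj V) where
  toFun x := trivialTensor.mk (groupAugmentation k H) (Rep.toModuleMonoidAlgebra.obj V)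
    (V.ρ.asModuleEquiv.symm x)
  map_add' x y := (congrArg _ (map_add V.ρ.asModuleEquiv.symm x y)).trans (map_add _ _ _)
  map_smul' r x := by
    rw [Representation.asModuleEquiv_symm_map_smul]
    refine (LinearMap.map_smulₛₗ _ _ _).trans ?_
    exact congrArg (fun r : k => r • _) ((groupAugmentation k H).commutes r)

/-- Group elements have augmentation `1`. This invariance is what lets the map descend to the
coinvariants. -/
theorem repTensorMk_rho (V : Rep.{u} k H) (g : H) (x : V) :
    repTensorMk k H V (V.ρ g x) = repTensorMk k H V x := by
  change trivialTensor.mk (groupAugmentation k H) (Rep.toModuleMonoidAlgebra.obj V)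
    (V.ρ.asModuleEquiv.symm (V.ρ g x)) = _
  rw [Representation.asModuleEquiv_symm_map_rho]
  refine (LinearMap.map_smulₛₗ _ _ _).trans ?_
  refine Eq.trans (congrArg (fun r : k => r • _) (groupAugmentation_single k H g 1)) ?_
  exact one_smul k (repTensorMk k H V x)

/-- The comparison map `(k ⊗ V)_H → 𝟙 ⊗_{k[H]} V`. -/
noncomputable def coinvariantsToTensor (V : Rep.{u} k H) :
    ((Rep.coinvariantsTensor k H).obj (Rep.trivial k H k)).obj V →ₗ[k]
      (trivialTensor (groupAugmentation k H)).obj (Rep.toModuleMonoidAlgebra.obj V) :=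
  Representation.Coinvariants.lift ((Rep.trivial k H k).ρ.tprod V.ρ)
    (TensorProduct.lift ((LinearMap.lsmul k _).flip.comp (repTensorMk k H V)).flip)
    fun g => TensorProduct.ext' fun (c : k) x =>
      congrArg (c • ·) (repTensorMk_rho k H V g x)

theorem tensorToCoinvariants_mk (V : Rep.{u} k H) (x : V) :
    tensorToCoinvariants k H V (repTensorMk k H V x) =
      Rep.coinvariantsTensorMk (Rep.trivial k H k) V (1 : k) x :=
  trivialTensor.lift_mk ..

/-- `𝟙 ⊗_{k[H]} V = (k ⊗ V)_H`. -/
noncomputable def trivialTensorIsoCoinvariants :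
    Rep.toModuleMonoidAlgebra ⋙ trivialTensor (groupAugmentation k H) ≅
      (Rep.coinvariantsTensor k H).obj (Rep.trivial k H k) :=
  NatIso.ofComponents (fun V => LinearEquiv.toModuleIso
    (LinearEquiv.ofLinearMap (tensorToCoinvariants k H V) (coinvariantsToTensor k H V)
      (Representation.Coinvariants.hom_ext (TensorProduct.ext' fun (c : k) x => by
        refine (map_smul (tensorToCoinvariants k H V) c (repTensorMk k H V x)).trans ?_
        refine (congrArg (c • ·) (tensorToCoinvariants_mk k H V x)).trans ?_
        change c • Rep.coinvariantsTensorMk (Rep.trivial k H k) V (1 : k) x =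
          Rep.coinvariantsTensorMk (Rep.trivial k H k) V c x
        rw [← LinearMap.smul_apply, ← map_smul, smul_eq_mul, mul_one]))
      (trivialTensor.hom_ext (groupAugmentation k H) (fun x =>
        (congrArg (coinvariantsToTensor k H V) (tensorToCoinvariants_mk k H V x)).trans
          (one_smul k (repTensorMk k H V x))))))
    fun {V W} f => by
      apply ModuleCat.hom_ext
      refine trivialTensor.hom_ext (groupAugmentation k H) fun x => ?_
      refine (tensorToCoinvariants_mk k H W (f.hom x)).trans ?_
      exact congrArg (((Rep.coinvariantsTensor k H).obj (Rep.trivial k H k)).map f).hom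
        (tensorToCoinvariants_mk k H V x).symm

/-- Needed to identify the coefficient module `𝟙` with the module of the trivial representation. -/
theorem trivial_asAlgebraHom (a : MonoidAlgebra k H) (x : k) :
    (Representation.trivial k H k).asAlgebraHom a x = groupAugmentation k H a * x := by
  induction a using MonoidAlgebra.induction_linear with
  | zero => simp
  | add f g hf hg => rw [map_add, LinearMap.add_apply, hf, hg, map_add, add_mul]
  | single g r =>
    rw [Representation.asAlgebraHom_single, groupAugmentation_single]
    rfl

/-- The trivial representation as a module over the group algebra. -/
noncomputable def trivialModuleIso :
    ModuleCat.of (MonoidAlgebra k H) (TrivialModule (groupAugmentation k H)) ≅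
      Rep.toModuleMonoidAlgebra.obj (Rep.trivial k H k) :=
  LinearEquiv.toModuleIso (X₂ := (Rep.trivial k H k).ρ.asModule)
    { AddEquiv.refl k with
      map_smul' := fun a x => (trivial_asAlgebraHom k H a x).symm }

/-- `Tor` of the trivial modules over a group algebra is group homology. -/
noncomputable def trivialTorIsoGroupHomology (q : ℕ) :
    trivialTor (groupAugmentation k H) q ≅ groupHomology (Rep.trivial k H k) q :=
  letI := Classical.decEq H
  ((trivialTensor (groupAugmentation k H)).leftDerived q).mapIso (trivialModuleIso k H) ≪≫
    -- The bar resolution, turned into a complex of modules over the group algebra, is a projective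
    -- resolution there. Tor and group homology are then homologies of two complexes that
    -- `trivialTensorIsoCoinvariants` identifies degreewise.
    (Rep.toModuleMonoidAlgebra.mapProjectiveResolution
      (Rep.barResolution k H)).isoLeftDerivedObj (trivialTensor (groupAugmentation k H)) q ≪≫
    (HomologicalComplex.homologyFunctor _ _ q).mapIso
      ((NatIso.mapHomologicalComplex (trivialTensorIsoCoinvariants k H) _).app
        (Rep.barResolution k H).complex) ≪≫
    (groupHomologyIso (Rep.trivial k H k) q (Rep.barResolution k H)).symm

end GroupHomology

/-! ### Gluing in any order, and gluing along straight edges -/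

namespace LabelledMatching

section GlueLists

variable {G k : Type u} [CommGroup G] [CommRing k] [MulSemiringAction G k]
variable {U W ι : Type} [DecidableEq U] [DecidableEq W]

/-- With `glue_left` and `glue_right`, a local rule for following a single edge through one gluing;
the computations of composites below use these rules instead of the global formula. -/
theorem glue_of_ne (m : LabelledMatching W G) {a b w : W} (hab : a ≠ b) (ha : w ≠ a) (hb : w ≠ b)
    (ha' : m.partner w ≠ a) (hb' : m.partner w ≠ b) :
    (m.glue a b hab).partner w = m.partner w ∧ (m.glue a b hab).label w = m.label w := by
  have h1 := m.partner_partner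
  simp only [glue]
  grind

theorem glue_left (m : LabelledMatching W G) {a b w : W} (hab : a ≠ b) (hb : w ≠ b)
    (ha' : m.partner a = w) :
    (m.glue a b hab).partner w = m.partner b ∧
      (m.glue a b hab).label w = m.label a * m.label b := by
  have h1 := m.partner_partner
  have h2 := m.partner_ne
  simp only [glue]
  grind

theorem glue_right (m : LabelledMatching W G) {a b w : W} (hab : a ≠ b) (ha : w ≠ a)
    (hb' : m.partner b = w) :
    (m.glue a b hab).partner w = m.partner a ∧
      (m.glue a b hab).label w = m.label a * m.label b := by
  have h1 := m.partner_partner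
  have h2 := m.partner_ne
  simp only [glue]
  grind

/-- Lists are glued from their end: the head of a list is glued last, so `l'` comes before `l`. -/
theorem glueList_append (m : LabelledMatching W G) (a b : ι → W) (hab : ∀ i, a i ≠ b i)
    (l l' : List ι) :
    m.glueList a b hab (l ++ l') = (m.glueList a b hab l').glueList a b hab l := by
  induction l with
  | nil => rfl
  | cons i l ih => simp only [List.cons_append, glueList, ih]

theorem loopWeight_append (δ : k) (m : LabelledMatching W G) (a b : ι → W)
    (hab : ∀ i, a i ≠ b i) (l l' : List ι) :
    m.loopWeight δ a b hab (l ++ l') =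
      m.loopWeight δ a b hab l' * (m.glueList a b hab l').loopWeight δ a b hab l := by
  induction l with
  | nil => simp [loopWeight]
  | cons i l ih => simp only [List.cons_append, loopWeight, ih, glueList_append, mul_assoc]

/-- Gluings at disjoint pairs commute. This allows the nodes on interesting edges to be glued first
when a composite is computed. -/
theorem glueList_perm (m : LabelledMatching W G) (a b : ι → W) (hab : ∀ i j, a i ≠ b j)
    (ha : Function.Injective a) (hb : Function.Injective b) {l l' : List ι} (h : l.Perm l') :
    m.glueList a b (fun i => hab i i) l = m.glueList a b (fun i => hab i i) l' := by
  induction h with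
  | nil => rfl
  | cons i _ ih => simp only [glueList, ih]
  | swap i j l =>
    by_cases hij : i = j
    · rw [hij]
    · simp only [glueList]
      exact glue_comm _ _ _ _ _ _ _ (ha.ne hij) (hab i j) (hab j i).symm (hb.ne hij)
  | trans _ _ ih ih' => rw [ih, ih']

theorem loopWeight_perm (δ : k) (m : LabelledMatching W G) (a b : ι → W)
    (hab : ∀ i j, a i ≠ b j) (ha : Function.Injective a) (hb : Function.Injective b)
    {l l' : List ι} (h : l.Perm l') :
    m.loopWeight δ a b (fun i => hab i i) l = m.loopWeight δ a b (fun i => hab i i) l' := by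
  induction h with
  | nil => rfl
  | cons i h ih => simp only [loopWeight, ih, glueList_perm m a b hab ha hb h]
  | swap i j l =>
    by_cases hij : i = j
    · rw [hij]
    · simp only [loopWeight, glueList, mul_assoc]
      rw [loopFactor_comm δ _ _ _ _ _ _ _ (ha.ne hij) (hab i j) (hab j i).symm (hb.ne hij)]
  | trans _ _ ih ih' => rw [ih, ih']

/-- An edge that avoids all glued nodes keeps its label. -/
theorem glueList_label_of_forall_ne (m : LabelledMatching W G) (a b : ι → W)
    (hab : ∀ i, a i ≠ b i) (v w : W) (hvw : m.partner v = w)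
    (hv : ∀ i, a i ≠ v ∧ b i ≠ v) (hw : ∀ i, a i ≠ w ∧ b i ≠ w) (l : List ι) :
    (m.glueList a b hab l).label v = m.label v := by
  induction l with
  | nil => rfl
  | cons j l ih =>
    have h := glueList_partner_of_forall_ne m a b hab v w hvw hv hw l
    rw [← ih]
    exact (glue_of_ne _ (hab j) (hv j).1.symm (hv j).2.symm (h ▸ (hw j).1.symm)
      (h ▸ (hw j).2.symm)).2

/-- Gluing nodes `u i` on edges from `a i` to `c i` with label `1` only moves the nodes `u i`
to `c i`. -/
theorem Induces.glueList_slide (δ : k) {f : U → W} (hf : Function.Injective f)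
    {m' : LabelledMatching U G} {m : LabelledMatching W G} (h : Induces f m' m)
    (a b c : ι → W) (hab : ∀ i j, a i ≠ b j) (hbc : ∀ i j, b i ≠ c j)
    (hac' : ∀ i j, a i ≠ c j) (ha : Function.Injective a) (hb : Function.Injective b)
    (hc : Function.Injective c) (u : ι → U) (l : List ι) (hl : l.Nodup) (hu : ∀ i ∈ l, f (u i) = b i)
    (hfa : ∀ i ∈ l, ∀ v, f v ≠ a i) (hfc : ∀ i ∈ l, ∀ v, f v ≠ c i)
    (hac : ∀ i ∈ l, m.partner (a i) = c i) (hlab : ∀ i ∈ l, m.label (a i) = 1)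
    (f' : U → W) (hf'u : ∀ i ∈ l, f' (u i) = c i)
    (hf' : ∀ v, (∀ i ∈ l, v ≠ u i) → f' v = f v) :
    Induces f' m' (m.glueList a b (fun i => hab i i) l) ∧
      m.loopWeight δ a b (fun i => hab i i) l = 1 := by
  -- The last entry is the one glued first, so it is split off from the end; the embedding `f` is
  -- replaced by the one that sends `u i` to `c i`.
  induction l using List.reverseRecOn generalizing f m with
  | nil =>
    obtain rfl : f' = f := funext fun v => hf' v (by simp)
    exact ⟨h, rfl⟩
  | append_singleton l i ih =>
    have hi : i ∉ l := fun hi => by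
      have := (List.nodup_append.1 hl).2.2 i hi i (by simp)
      exact this rfl
    have mem : ∀ j ∈ l, j ∈ l ++ [i] := fun j hj => List.mem_append_left _ hj
    have memi : i ∈ l ++ [i] := by simp
    have hui : f (u i) = b i := hu i memi
    have hau : a i ≠ f (u i) := by rw [hui]; exact hab i i
    have h1 := h.glue_update hf (a i) (c i) (u i) hau (hfa i memi) (hfc i memi) (hac i memi)
      (hlab i memi)
    have e : m.glue (a i) (f (u i)) hau = m.glueList a b (fun i => hab i i) [i] := by
      simp only [hui]
      rfl
    have hne : ∀ j ∈ l, u j ≠ u i := fun j hj he => by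
      have := hu j (mem j hj)
      rw [he, hui] at this
      exact hi (hb this ▸ hj)
    have hff : Function.Injective (Function.update f (u i) (c i)) := by
      intro v w hvw
      simp only [Function.update_apply] at hvw
      have h2 := hfc i memi
      have h3 := @hf v w
      grind
    -- The first gluing leaves the remaining edges from `a j` to `c j` alone, so they keep label
    -- `1`.
    have hkeep : ∀ j ∈ l, (m.glueList a b (fun i => hab i i) [i]).partner (a j) = m.partner (a j) ∧
        (m.glueList a b (fun i => hab i i) [i]).label (a j) = m.label (a j) := by
      intro j hj
      have hji : j ≠ i := fun he => hi (he ▸ hj)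
      refine glue_of_ne _ _ (ha.ne hji) (hab j i) ?_ ?_
      · exact (hac j (mem j hj)).trans_ne (hac' i j).symm
      · exact (hac j (mem j hj)).trans_ne (hbc i j).symm
    rw [e] at h1
    rw [glueList_append, loopWeight_append]
    obtain ⟨h3, h4⟩ := ih (f := Function.update f (u i) (c i)) hff h1 (List.nodup_append.1 hl).1
      (fun j hj => by rw [Function.update_of_ne (hne j hj), hu j (mem j hj)])
      (fun j hj v => by
        have := hfa j (mem j hj) v
        have h5 := hac' j i
        simp only [Function.update_apply]
        grind)
      (fun j hj v => by
        have := hfc j (mem j hj) v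
        have h5 : c i ≠ c j := hc.ne fun he => hi (he ▸ hj)
        simp only [Function.update_apply]
        grind)
      (fun j hj => by rw [(hkeep j hj).1, hac j (mem j hj)])
      (fun j hj => by rw [(hkeep j hj).2, hlab j (mem j hj)])
      (fun j hj => hf'u j (mem j hj))
      (fun v hv => by
        by_cases hvi : v = u i
        · rw [hvi, Function.update_self, hf'u i memi]
        · rw [Function.update_of_ne hvi]
          refine hf' v fun j hj => ?_
          rcases List.mem_append.1 hj with hj | hj
          · exact hv j hj
          · rw [List.mem_singleton.1 hj]; exact hvi)
    refine ⟨h3, ?_⟩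
    rw [h4, mul_one]
    simp only [LabelledMatching.loopWeight, LabelledMatching.glueList,
      LabelledMatching.loopFactor, hac i memi, one_mul]
    -- No loop closes, because `a i` is joined to `c i` and not to `b i`.
    rw [if_neg (hbc i i).symm]

end GlueLists

end LabelledMatching

/-! ### Left edges and the diagrams that absorb them -/

namespace GBrauerDiagram

open LabelledMatching

section LeftEdges

variable {G k : Type u} [CommGroup G] [CommRing k] [MulSemiringAction G k] {n : ℕ}

theorem midLeft_injective : Function.Injective (midLeft (n := n)) :=
  Sum.inl_injective.comp Sum.inr_injective

theorem midRight_injective : Function.Injective (midRight (n := n)) :=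
  Sum.inr_injective.comp Sum.inl_injective

/-- The diagram `x` has an edge labelled `t.2.2` between the left nodes `t.1` and `t.2.1`. -/
def HasLeftEdge (x : GBrauerDiagram G n) (t : Fin n × Fin n × G) : Prop :=
  x.partner (Sum.inl t.1) = Sum.inl t.2.1 ∧ x.label (Sum.inl t.1) = t.2.2

/-- A left edge of the first factor does not meet the middle column, so no gluing changes it. Hence
diagrams with prescribed left edges span a right ideal. -/
theorem HasLeftEdge.comp {x : GBrauerDiagram G n} {t : Fin n × Fin n × G} (h : x.HasLeftEdge t)
    (y : GBrauerDiagram G n) : (GBrauerDiagram.comp x y).HasLeftEdge t := by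
  have h1 : (x.disjSum y).partner (outer (Sum.inl t.1)) = outer (Sum.inl t.2.1) := by
    simp [disjSum, outer, h.1]
  have hne : ∀ (j : Fin n) i, midLeft i ≠ outer (Sum.inl j) ∧ midRight i ≠ outer (Sum.inl j) := by
    simp [midLeft, midRight, outer]
  have h2 := glueList_partner_of_forall_ne _ midLeft midRight (fun i => midLeft_ne_midRight i i)
    _ _ h1 (hne _) (hne _) (List.finRange n)
  have h3 := glueList_label_of_forall_ne _ midLeft midRight (fun i => midLeft_ne_midRight i i)
    _ _ h1 (hne _) (hne _) (List.finRange n)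
  have hc := comp_induces x y
  constructor
  · exact outer_injective ((hc.1 _).symm.trans h2)
  · exact (hc.2 _).symm.trans (h3.trans h.2)

/-- The concatenation may be computed by gluing in any order. -/
theorem concat_eq_of_perm (x y : GBrauerDiagram G n) {l : List (Fin n)}
    (hl : (List.finRange n).Perm l) :
    concat x y = (x.disjSum y).glueList midLeft midRight (fun i => midLeft_ne_midRight i i) l :=
  glueList_perm _ _ _ midLeft_ne_midRight midLeft_injective midRight_injective hl

theorem weight_eq_of_perm (δ : k) (x y : GBrauerDiagram G n) {l : List (Fin n)}
    (hl : (List.finRange n).Perm l) :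
    weight δ x y =
      (x.disjSum y).loopWeight δ midLeft midRight (fun i => midLeft_ne_midRight i i) l :=
  loopWeight_perm δ _ _ _ midLeft_ne_midRight midLeft_injective midRight_injective hl

/-- Left edges of `y` whose ends `x` joins trivially to its left column are left edges of the
composite. -/
theorem HasLeftEdge.comp_left {y : GBrauerDiagram G n} {t : Fin n × Fin n × G}
    (h : y.HasLeftEdge t) (x : GBrauerDiagram G n)
    (h1 : x.partner (Sum.inl t.1) = Sum.inr t.1) (h1' : x.label (Sum.inl t.1) = 1)
    (h2 : x.partner (Sum.inl t.2.1) = Sum.inr t.2.1) (h2' : x.label (Sum.inl t.2.1) = 1) :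
    (GBrauerDiagram.comp x y).HasLeftEdge t := by
  obtain ⟨a, b, g⟩ := t
  simp only [HasLeftEdge] at *
  have hab : a ≠ b := fun e => y.partner_ne (Sum.inl a) (by rw [h.1, e])
  -- Gluing at `a` and then at `b` completes the path from left `a` through the edge of `y` to left
  -- `b`; its label is `1 * g * 1`. It no longer meets the middle, so the other gluings do not
  -- affect it.
  have hperm : (List.finRange n).Perm (((List.finRange n).erase a).erase b ++ [b, a]) := by
    refine (List.perm_cons_erase (List.mem_finRange a)).trans ?_
    refine (List.Perm.cons a (List.perm_cons_erase
      ((List.mem_erase_of_ne hab.symm).2 (List.mem_finRange b)))).trans ?_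
    refine (List.Perm.swap _ _ _).trans ?_
    exact List.perm_append_comm (l₁ := [b, a])
  have hc := comp_induces x y
  rw [concat_eq_of_perm x y hperm, glueList_append] at hc
  set m := x.disjSum y with hm
  have e1 : m.partner (midLeft a) = outer (Sum.inl a) := by
    have := x.partner_partner (Sum.inl a)
    rw [h1] at this
    simp [hm, disjSum, midLeft, outer, this]
  have e1' : m.label (midLeft a) = 1 := by
    rw [← m.label_partner, e1]
    exact h1'
  have e2 : m.partner (midLeft b) = outer (Sum.inl b) := by
    have := x.partner_partner (Sum.inl b)
    rw [h2] at this
    simp [hm, disjSum, midLeft, outer, this]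
  have e2' : m.label (midLeft b) = 1 := by
    rw [← m.label_partner, e2]
    exact h2'
  have e3 : m.partner (midRight a) = midRight b := by
    simp [hm, disjSum, midRight, h.1]
  have e3' : m.label (midRight a) = g := h.2
  have n1 : ∀ i j : Fin n, outer (Sum.inl i) ≠ midLeft j := by simp [midLeft, outer]
  have n2 : ∀ i j : Fin n, outer (Sum.inl i) ≠ midRight j := by simp [midRight, outer]
  obtain ⟨f1, f1'⟩ := glue_left m (midLeft_ne_midRight a a) (n2 a a) e1
  obtain ⟨f2, f2'⟩ := glue_of_ne m (midLeft_ne_midRight a a) (midLeft_injective.ne hab.symm)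
    (midLeft_ne_midRight b a) (by rw [e2]; exact n1 b a) (by rw [e2]; exact n2 b a)
  set m1 := m.glue (midLeft a) (midRight a) (midLeft_ne_midRight a a) with hm1
  rw [e3] at f1
  rw [e1', e3', one_mul] at f1'
  rw [e2] at f2
  rw [e2'] at f2'
  have f1r : m1.partner (midRight b) = outer (Sum.inl a) := by rw [← f1, m1.partner_partner]
  obtain ⟨k1, k1'⟩ := glue_right m1 (midLeft_ne_midRight b b) (n1 a b) f1r
  rw [f2] at k1
  rw [f2', one_mul, ← m1.label_partner, f1r, f1'] at k1'
  have hne : ∀ (j : Fin n) i, midLeft i ≠ outer (Sum.inl j) ∧ midRight i ≠ outer (Sum.inl j) :=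
    fun j i => ⟨(n1 j i).symm, (n2 j i).symm⟩
  constructor
  · exact outer_injective ((hc.1 _).symm.trans
      (glueList_partner_of_forall_ne _ midLeft midRight _ _ _ k1 (hne _) (hne _) _))
  · exact (hc.2 _).symm.trans
      ((glueList_label_of_forall_ne _ midLeft midRight _ _ _ k1 (hne _) (hne _) _).trans k1')

/-- The diagram with a left edge `a - b` labelled `g`, a right edge `b - c` labelled `g⁻¹`, the
left node `c` joined to the right node `a`, and all other nodes joined to the opposite ones. -/
def absorber (a b c : Fin n) (g : G) (hab : a ≠ b) (hac : a ≠ c) (hbc : b ≠ c) :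
    GBrauerDiagram G n where
  partner := Sum.elim
    (fun i => if i = a then Sum.inl b else if i = b then Sum.inl a
      else if i = c then Sum.inr a else Sum.inr i)
    (fun i => if i = a then Sum.inl c else if i = b then Sum.inr c
      else if i = c then Sum.inr b else Sum.inl i)
  label := Sum.elim (fun i => if i = a ∨ i = b then g else 1)
    (fun i => if i = b ∨ i = c then g⁻¹ else 1)
  partner_partner := by rintro (i | i) <;> simp only [Sum.elim_inl, Sum.elim_inr] <;> grind
  partner_ne := by rintro (i | i) <;> simp only [Sum.elim_inl, Sum.elim_inr] <;> grind
  label_partner := by rintro (i | i) <;> simp only [Sum.elim_inl, Sum.elim_inr] <;> grind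

/-- The absorber contributes the left edge from `a` to `b` itself. The edge of `y` from `a` to `b`
becomes part of the path that starts at left `c`, runs to middle `a`, along `y` to middle `b`, back
along the right edge of the absorber to middle `c`, and then along the edge of `y` at `c`. The
labels `g` and `g⁻¹` on the way cancel, so `c` ends up with the edge it has in `y`. All other nodes
are straight and no loop arises, whence weight `1` for every `δ`. -/
theorem absorber_comp (δ : k) {a b c : Fin n} {g : G} (hab : a ≠ b) (hac : a ≠ c) (hbc : b ≠ c)
    {y : GBrauerDiagram G n} (h : y.HasLeftEdge (a, b, g)) :
    comp (absorber a b c g hab hac hbc) y = y ∧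
      weight δ (absorber a b c g hab hac hbc) y = 1 := by
  obtain ⟨hy, hyg⟩ := h
  simp only at hy hyg
  -- The order of gluing is `a`, `b`, `c`, and then the nodes in `l`, at which the absorber is
  -- straight.
  have hperm : (List.finRange n).Perm
      ((((List.finRange n).erase a).erase b).erase c ++ [c, b, a]) := by
    refine (List.perm_cons_erase (List.mem_finRange a)).trans ?_
    refine (List.Perm.cons a (List.perm_cons_erase
      ((List.mem_erase_of_ne hab.symm).2 (List.mem_finRange b)))).trans ?_
    refine (List.Perm.cons a (List.Perm.cons b (List.perm_cons_erase
      ((List.mem_erase_of_ne hbc.symm).2 ((List.mem_erase_of_ne hac.symm).2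
        (List.mem_finRange c)))))).trans ?_
    refine List.Perm.trans ?_ (List.perm_append_comm (l₁ := [c, b, a]))
    exact List.Perm.append_right _ (l₁ := [a, b, c]) (List.reverse_perm [a, b, c]).symm
  set l := (((List.finRange n).erase a).erase b).erase c with hl
  have hlnd : l.Nodup := (((List.nodup_finRange n).erase a).erase b).erase c
  have hlmem : ∀ i, i ∈ l ↔ i ≠ a ∧ i ≠ b ∧ i ≠ c := by
    intro i
    rw [hl, (((List.nodup_finRange n).erase a).erase b).mem_erase_iff,
      ((List.nodup_finRange n).erase a).mem_erase_iff, (List.nodup_finRange n).mem_erase_iff]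
    simp only [List.mem_finRange, and_true]
    tauto
  set x := absorber a b c g hab hac hbc with hx
  set m := x.disjSum y with hm
  have hmid : Function.Injective (fun i : Fin n => (outer (Sum.inl i) :
      (Fin n ⊕ Fin n) ⊕ (Fin n ⊕ Fin n))) := outer_injective.comp Sum.inl_injective
  have n1 : ∀ i j : Fin n, outer (Sum.inl i) ≠ midLeft j := by simp [midLeft, outer]
  have n2 : ∀ i j : Fin n, outer (Sum.inl i) ≠ midRight j := by simp [midRight, outer]
  have n3 : ∀ (v : Fin n ⊕ Fin n) (j : Fin n), Sum.inr v ≠ midLeft j := by simp [midLeft]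
  have n4 : ∀ (v : Fin n ⊕ Fin n) (j : Fin n), Sum.inr v ≠ outer (Sum.inl j) := by simp [outer]
  have mr : ∀ v, m.partner (Sum.inr v) = Sum.inr (y.partner v) := fun v => rfl
  have mrl : ∀ v, m.label (Sum.inr v) = y.label v := fun v => rfl
  have hyb : y.partner (Sum.inl b) = Sum.inl a := by rw [← hy, y.partner_partner]
  have hyb' : y.label (Sum.inl b) = g := by rw [← hy, y.label_partner, hyg]
  -- the edges of the disjoint union that take part in the first three gluings
  have pa : m.partner (midLeft a) = outer (Sum.inl c) := by
    simp [hm, hx, disjSum, absorber, midLeft, outer]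
  have la : m.label (midLeft a) = 1 := by
    simp [hm, hx, disjSum, absorber, midLeft, hab, hac]
  have pb : m.partner (midLeft b) = midLeft c := by
    simp [hm, hx, disjSum, absorber, midLeft, hab.symm]
  have lb : m.label (midLeft b) = g⁻¹ := by
    simp [hm, hx, disjSum, absorber, midLeft]
  have pl : m.partner (outer (Sum.inl a)) = outer (Sum.inl b) := by
    simp [hm, hx, disjSum, absorber, outer]
  have ll : m.label (outer (Sum.inl a)) = g := by
    simp [hm, hx, disjSum, absorber, outer]
  have po : ∀ i ∈ l, m.partner (midLeft i) = outer (Sum.inl i) := by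
    intro i hi
    obtain ⟨h1, h2, h3⟩ := (hlmem i).1 hi
    simp [hm, hx, disjSum, absorber, midLeft, outer, h1, h2, h3]
  have lo : ∀ i ∈ l, m.label (midLeft i) = 1 := by
    intro i hi
    obtain ⟨h1, h2, h3⟩ := (hlmem i).1 hi
    simp [hm, hx, disjSum, absorber, midLeft, h2, h3]
  have ra : m.partner (midRight a) = midRight b := by simp [midRight, mr, hy]
  have rla : m.label (midRight a) = g := hyg
  -- gluing at `a`
  set m1 := m.glue (midLeft a) (midRight a) (midLeft_ne_midRight a a) with hm1
  obtain ⟨c1, c1'⟩ := glue_left m (midLeft_ne_midRight a a) (n2 c a) pa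
  have keep1 : ∀ w, w ≠ midLeft a → w ≠ midRight a → m.partner w ≠ midLeft a →
      m.partner w ≠ midRight a → m1.partner w = m.partner w ∧ m1.label w = m.label w :=
    fun w => glue_of_ne m (midLeft_ne_midRight a a)
  rw [← hm1, ra] at c1
  rw [← hm1, la, rla, one_mul] at c1'
  obtain ⟨b1, b1'⟩ := keep1 (midLeft b) (midLeft_injective.ne hab.symm)
    (midLeft_ne_midRight _ _) (by rw [pb]; exact midLeft_injective.ne hac.symm)
    (by rw [pb]; exact midLeft_ne_midRight _ _)
  rw [pb] at b1
  rw [lb] at b1'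
  have c1r : m1.partner (midRight b) = outer (Sum.inl c) := by rw [← c1, m1.partner_partner]
  have c1r' : m1.label (midRight b) = g := by rw [← c1', ← c1, m1.label_partner]
  -- gluing at `b`
  set m2 := m1.glue (midLeft b) (midRight b) (midLeft_ne_midRight b b) with hm2
  obtain ⟨c2, c2'⟩ := glue_right m1 (midLeft_ne_midRight b b) (n1 c b) c1r
  have keep2 : ∀ w, w ≠ midLeft b → w ≠ midRight b → m1.partner w ≠ midLeft b →
      m1.partner w ≠ midRight b → m2.partner w = m1.partner w ∧ m2.label w = m1.label w :=
    fun w => glue_of_ne m1 (midLeft_ne_midRight b b)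
  rw [← hm2, b1] at c2
  rw [← hm2, b1', c1r', inv_mul_cancel] at c2'
  have c2r : m2.partner (midLeft c) = outer (Sum.inl c) := by rw [← c2, m2.partner_partner]
  have c2r' : m2.label (midLeft c) = 1 := by rw [← c2', ← c2, m2.label_partner]
  -- gluing at `c`
  set m3 := m2.glue (midLeft c) (midRight c) (midLeft_ne_midRight c c) with hm3
  have keep3 : ∀ w, w ≠ midLeft c → w ≠ midRight c → m2.partner w ≠ midLeft c →
      m2.partner w ≠ midRight c → m3.partner w = m2.partner w ∧ m3.label w = m2.label w :=
    fun w => glue_of_ne m2 (midLeft_ne_midRight c c)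
  have keep : ∀ w, (∀ i, i = a ∨ i = b ∨ i = c → w ≠ midLeft i ∧ w ≠ midRight i ∧
      m.partner w ≠ midLeft i ∧ m.partner w ≠ midRight i) →
      m3.partner w = m.partner w ∧ m3.label w = m.label w := by
    intro w hw
    obtain ⟨a1, a2, a3, a4⟩ := hw a (Or.inl rfl)
    obtain ⟨a5, a6, a7, a8⟩ := hw b (Or.inr (Or.inl rfl))
    obtain ⟨a9, a10, a11, a12⟩ := hw c (Or.inr (Or.inr rfl))
    obtain ⟨k1, k1'⟩ := keep1 w a1 a2 a3 a4
    obtain ⟨k2, k2'⟩ := keep2 w a5 a6 (by rwa [k1]) (by rwa [k1])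
    obtain ⟨k3, k3'⟩ := keep3 w a9 a10 (by rwa [k2, k1]) (by rwa [k2, k1])
    exact ⟨by rw [k3, k2, k1], by rw [k3', k2', k1']⟩
  -- The nodes `a` and `b` are joined to each other in `y`, so the edge of `y` at `c` ends elsewhere
  -- and survives the first two gluings.
  have hva : y.partner (Sum.inl c) ≠ Sum.inl a := fun e => by
    rw [← e, y.partner_partner] at hy
    exact hbc (Sum.inl_injective hy).symm
  have hvb : y.partner (Sum.inl c) ≠ Sum.inl b := fun e => by
    rw [← e, y.partner_partner] at hyb
    exact hac (Sum.inl_injective hyb).symm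
  have hvc := y.partner_ne (Sum.inl c)
  have inr_ne : ∀ (v : Fin n ⊕ Fin n) (i : Fin n), v ≠ Sum.inl i →
      (Sum.inr v : (Fin n ⊕ Fin n) ⊕ (Fin n ⊕ Fin n)) ≠ midRight i :=
    fun v i hv => Sum.inr_injective.ne hv
  obtain ⟨r1, r1'⟩ := keep1 (midRight c) (midLeft_ne_midRight _ _).symm
    (midRight_injective.ne hac.symm) (n3 _ _) (inr_ne _ _ hva)
  obtain ⟨r2, r2'⟩ := keep2 (midRight c) (midLeft_ne_midRight _ _).symm
    (midRight_injective.ne hbc.symm) (by rw [r1]; exact n3 _ _) (by rw [r1]; exact inr_ne _ _ hvb)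
  obtain ⟨c3, c3'⟩ := glue_left m2 (midLeft_ne_midRight c c) (n2 c c) c2r
  rw [← hm3, r2, r1] at c3
  rw [← hm3, c2r', one_mul, r2', r1'] at c3'
  have c3r : m3.partner (Sum.inr (y.partner (Sum.inl c))) = outer (Sum.inl c) :=
    (congrArg m3.partner c3).symm.trans (m3.partner_partner _)
  have c3r' : m3.label (Sum.inr (y.partner (Sum.inl c))) = y.label (Sum.inl c) :=
    ((congrArg m3.label c3).symm.trans (m3.label_partner _)).trans c3'
  obtain ⟨ka, ka'⟩ := keep (outer (Sum.inl a)) fun i _ =>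
    ⟨n1 a i, n2 a i, by rw [pl]; exact n1 b i, by rw [pl]; exact n2 b i⟩
  rw [pl] at ka
  rw [ll] at ka'
  have kb : m3.partner (outer (Sum.inl b)) = outer (Sum.inl a) := by
    rw [← ka, m3.partner_partner]
  have kb' : m3.label (outer (Sum.inl b)) = g := by rw [← ka', ← ka, m3.label_partner]
  -- The position of `y` after three gluings: `a`, `b` and `c` have reached the outer left column,
  -- and the left nodes in `l` are still in the middle.
  let f : Fin n ⊕ Fin n → (Fin n ⊕ Fin n) ⊕ (Fin n ⊕ Fin n) :=
    Sum.elim (fun i => if i ∈ l then Sum.inr (Sum.inl i) else outer (Sum.inl i))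
      (fun j => Sum.inr (Sum.inr j))
  have fa : f (Sum.inl a) = outer (Sum.inl a) := if_neg fun h => ((hlmem a).1 h).1 rfl
  have fb : f (Sum.inl b) = outer (Sum.inl b) := if_neg fun h => ((hlmem b).1 h).2.1 rfl
  have fc : f (Sum.inl c) = outer (Sum.inl c) := if_neg fun h => ((hlmem c).1 h).2.2 rfl
  have fo : ∀ v, v ≠ Sum.inl a → v ≠ Sum.inl b → v ≠ Sum.inl c → f v = Sum.inr v := by
    rintro (i | j) h1 h2 h3
    · exact if_pos ((hlmem i).2 ⟨fun e => h1 (e ▸ rfl), fun e => h2 (e ▸ rfl),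
        fun e => h3 (e ▸ rfl)⟩)
    · rfl
  have hfi : Function.Injective f := by
    rintro (i | i) (j | j) hij <;> simp only [f, Sum.elim_inl, Sum.elim_inr] at hij
    · split_ifs at hij
      · exact Sum.inr_injective hij
      · exact absurd hij (n4 _ _)
      · exact absurd hij.symm (n4 _ _)
      · rw [hmid hij]
    · split_ifs at hij
      · exact absurd (Sum.inr_injective hij) Sum.inl_ne_inr
      · exact absurd hij.symm (n4 _ _)
    · split_ifs at hij
      · exact absurd (Sum.inr_injective hij) Sum.inr_ne_inl
      · exact absurd hij (n4 _ _)
    · exact Sum.inr_injective hij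
  have hind : Induces f y m3 := by
    have hall : ∀ v, m3.partner (f v) = f (y.partner v) ∧ m3.label (f v) = y.label v := by
      intro v
      by_cases va : v = Sum.inl a
      · rw [va, fa, hy, fb, hyg]
        exact ⟨ka, ka'⟩
      by_cases vb : v = Sum.inl b
      · rw [vb, fb, hyb, fa, hyb']
        exact ⟨kb, kb'⟩
      by_cases vc : v = Sum.inl c
      · rw [vc, fc, fo _ hva hvb hvc]
        exact ⟨c3, c3'⟩
      rw [fo v va vb vc]
      -- Besides `a`, `b` and `c`, the other end of the edge at `c` is the only node whose edge has
      -- been rerouted.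
      by_cases vd : y.partner v = Sum.inl c
      · have hv : v = y.partner (Sum.inl c) := by rw [← vd, y.partner_partner]
        rw [vd, fc, hv, y.label_partner]
        exact ⟨c3r, c3r'⟩
      have vd' : y.partner v ≠ Sum.inl a := fun e => vb (by rw [← hy, ← e, y.partner_partner])
      have vd'' : y.partner v ≠ Sum.inl b := fun e => va (by rw [← hyb, ← e, y.partner_partner])
      rw [fo _ vd' vd'' vd]
      refine keep (Sum.inr v) fun i hi => ⟨n3 _ _, inr_ne _ _ ?_, n3 _ _, inr_ne _ _ ?_⟩
      · rcases hi with rfl | rfl | rfl <;> assumption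
      · rcases hi with rfl | rfl | rfl <;> assumption
    exact ⟨fun v => (hall v).1, fun v => (hall v).2⟩
  have ko : ∀ i ∈ l, m3.partner (midLeft i) = outer (Sum.inl i) ∧ m3.label (midLeft i) = 1 := by
    intro i hi
    have hil := (hlmem i).1 hi
    obtain ⟨h1, h2⟩ := keep (midLeft i) fun j hj =>
      ⟨midLeft_injective.ne fun e => by rcases hj with rfl | rfl | rfl <;> tauto,
        midLeft_ne_midRight _ _, by rw [po i hi]; exact n1 _ _, by rw [po i hi]; exact n2 _ _⟩
    exact ⟨h1.trans (po i hi), h2.trans (lo i hi)⟩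
  -- The remaining nodes slide along straight edges with label `1` to the outer column, which turns
  -- `f` into `outer`.
  obtain ⟨s1, s2⟩ := hind.glueList_slide δ hfi midLeft midRight (fun i => outer (Sum.inl i))
    midLeft_ne_midRight (fun i j => (n2 j i).symm) (fun i j => (n1 j i).symm) midLeft_injective
    midRight_injective hmid Sum.inl l hlnd (fun i hi => if_pos hi)
    (fun i hi v => by
      rcases v with j | j <;> simp only [f, Sum.elim_inl, Sum.elim_inr]
      · split_ifs
        · exact n3 _ _
        · exact n1 _ _
      · exact n3 _ _)
    (fun i hi v => by
      rcases v with j | j <;> simp only [f, Sum.elim_inl, Sum.elim_inr]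
      · split_ifs with hj
        · exact n4 _ _
        · exact hmid.ne fun e => hj (e ▸ hi)
      · exact n4 _ _)
    (fun i hi => (ko i hi).1) (fun i hi => (ko i hi).2) outer (fun i hi => rfl)
    (by
      rintro (j | j) hj
      · exact (if_neg fun h => hj j h rfl).symm
      · rfl)
  have hglue : m.glueList midLeft midRight (fun i => midLeft_ne_midRight i i) [c, b, a] = m3 := rfl
  constructor
  · have hc := comp_induces x y
    rw [concat_eq_of_perm x y hperm, glueList_append, ← hm, hglue] at hc
    exact hc.unique outer_injective s1
  · rw [weight_eq_of_perm δ x y hperm, loopWeight_append, ← hm, hglue, s2, mul_one]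
    -- When `a`, `b` and `c` are glued, their left copies are joined to outer `c`, middle `c` and
    -- outer `c`, never to the node they are glued to; all three factors are `1`.
    simp only [loopWeight, glueList, loopFactor, ← hm1, ← hm2, pa, b1, c2r, one_mul]
    rw [if_neg (n2 _ _), if_neg (midLeft_ne_midRight _ _), if_neg (n2 _ _), one_mul, one_mul]

end LeftEdges

end GBrauerDiagram

/-! ### Through diagrams as the group `G^n ⋊ Σ_n`, and parity -/

namespace GBrauerDiagram

open LabelledMatching

section Through

set_option linter.unusedSectionVars false

variable {G k : Type u} [CommGroup G] [CommRing k] [MulSemiringAction G k] {n : ℕ}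

/-- The edge of a composite that is made up of one edge of each factor. -/
theorem comp_left_to_right {x y : GBrauerDiagram G n} {i j p : Fin n}
    (hx : x.partner (Sum.inl i) = Sum.inr j) (hy : y.partner (Sum.inl j) = Sum.inr p) :
    (comp x y).partner (Sum.inl i) = Sum.inr p ∧
      (comp x y).label (Sum.inl i) = x.label (Sum.inl i) * y.label (Sum.inl j) := by
  have hperm : (List.finRange n).Perm ((List.finRange n).erase j ++ [j]) :=
    (List.perm_cons_erase (List.mem_finRange j)).trans (List.perm_append_comm (l₁ := [j]))
  have hc := comp_induces x y
  rw [concat_eq_of_perm x y hperm, glueList_append] at hc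
  set m := x.disjSum y with hm
  have hx' : x.partner (Sum.inr j) = Sum.inl i := by rw [← hx, x.partner_partner]
  have e1 : m.partner (midLeft j) = outer (Sum.inl i) := by
    simp [hm, disjSum, midLeft, outer, hx']
  have e1' : m.label (midLeft j) = x.label (Sum.inl i) := by rw [← m.label_partner, e1]; rfl
  have e2 : m.partner (midRight j) = outer (Sum.inr p) := by
    simp [hm, disjSum, midRight, outer, hy]
  have e2' : m.label (midRight j) = y.label (Sum.inl j) := rfl
  have n1 : ∀ (v : Fin n ⊕ Fin n) (q : Fin n), midLeft q ≠ outer v := by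
    rintro (v | v) q <;> simp [midLeft, outer]
  have n2 : ∀ (v : Fin n ⊕ Fin n) (q : Fin n), midRight q ≠ outer v := by
    rintro (v | v) q <;> simp [midRight, outer]
  obtain ⟨k1, k1'⟩ := glue_left m (midLeft_ne_midRight j j) (n2 _ j).symm e1
  rw [e2] at k1
  rw [e1', e2'] at k1'
  have hne : ∀ v i, midLeft i ≠ outer v ∧ midRight i ≠ outer (n := n) v :=
    fun v i => ⟨n1 v i, n2 v i⟩
  constructor
  · exact outer_injective ((hc.1 _).symm.trans
      (glueList_partner_of_forall_ne _ midLeft midRight _ _ _ k1 (hne _) (hne _) _))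
  · exact (hc.2 _).symm.trans
      ((glueList_label_of_forall_ne _ midLeft midRight _ _ _ k1 (hne _) (hne _) _).trans k1')

/-- In a through diagram every right node is the partner of a left node, so the data at the left
nodes determine everything. -/
theorem IsThrough.ext {x y : GBrauerDiagram G n} (hx : x.IsThrough)
    (hp : ∀ i, y.partner (Sum.inl i) = x.partner (Sum.inl i))
    (hl : ∀ i, y.label (Sum.inl i) = x.label (Sum.inl i)) : y = x := by
  have key : ∀ v, y.partner v = x.partner v ∧ y.label v = x.label v := by
    rintro (i | j)
    · exact ⟨hp i, hl i⟩
    · obtain ⟨i, hi⟩ := Sum.isLeft_iff.1 (hx.2 j)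
      have hj : x.partner (Sum.inl i) = Sum.inr j := by rw [← hi, x.partner_partner]
      have hj' : y.partner (Sum.inl i) = Sum.inr j := (hp i).trans hj
      constructor
      · rw [hi, ← hj', y.partner_partner]
      · rw [← hj', y.label_partner, hl, hj', ← hj, x.label_partner]
  ext v
  · exact (key v).1
  · exact (key v).2

/-- The diagram of an element `(f, σ)` of `G^n ⋊ Σ_n`: the right node `j` is joined to the left
node `σ j`, and the edge at the left node `i` is labelled by `f i`. -/
def ofSymmSemidirect (h : SymmSemidirect G n) : GBrauerDiagram G n where
  partner := Sum.elim (fun i => Sum.inr (h.right⁻¹ i)) (fun j => Sum.inl (h.right j))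
  label := Sum.elim h.left (fun j => h.left (h.right j))
  partner_partner := by rintro (i | i) <;> simp
  partner_ne := by rintro (i | i) <;> simp
  label_partner := by rintro (i | i) <;> simp

theorem isThrough_ofSymmSemidirect (h : SymmSemidirect G n) : (ofSymmSemidirect h).IsThrough :=
  ⟨fun _ => rfl, fun _ => rfl⟩

theorem ofSymmSemidirect_injective : Function.Injective (ofSymmSemidirect (G := G) (n := n)) := by
  intro h h' e
  refine SemidirectProduct.ext ?_ ?_
  · funext i
    exact congrArg (fun x => x.label (Sum.inl i)) e
  · ext j
    exact congrArg Fin.val (Sum.inl_injective (congrArg (fun x => x.partner (Sum.inr j)) e))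

/-- Passing to partners gives mutually inverse maps between the two columns, hence a permutation;
the labels at the left nodes give the element of `G^n`. -/
theorem IsThrough.exists_eq {x : GBrauerDiagram G n} (hx : x.IsThrough) :
    ∃ h, ofSymmSemidirect h = x := by
  choose f hf using fun i => Sum.isRight_iff.1 (hx.1 i)
  choose f' hf' using fun i => Sum.isLeft_iff.1 (hx.2 i)
  have h1 : ∀ i, f' (f i) = i := fun i => Sum.inl_injective (β := Fin n) (by
    rw [← hf', ← hf, x.partner_partner])
  have h2 : ∀ i, f (f' i) = i := fun i => Sum.inr_injective (α := Fin n) (by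
    rw [← hf, ← hf', x.partner_partner])
  exact ⟨⟨fun i => x.label (Sum.inl i), ⟨f', f, h2, h1⟩⟩,
    hx.ext (fun i => (hf i).symm) fun i => rfl⟩

/-- For `h = (f, σ)` and `h' = (f', σ')`, the path from left `i` passes through middle `σ⁻¹ i`, ends
at right `(σ σ')⁻¹ i` and has label `f i * f' (σ⁻¹ i)`. This is the semidirect product for the
action with `(σ f') i = f' (σ⁻¹ i)`. -/
theorem ofSymmSemidirect_mul (h h' : SymmSemidirect G n) :
    comp (ofSymmSemidirect h) (ofSymmSemidirect h') = ofSymmSemidirect (h * h') := by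
  refine (isThrough_ofSymmSemidirect _).ext (fun i => ?_) fun i => ?_
  · rw [(comp_left_to_right (p := h'.right⁻¹ (h.right⁻¹ i)) (j := h.right⁻¹ i) rfl rfl).1]
    simp [ofSymmSemidirect]
  · rw [(comp_left_to_right (p := h'.right⁻¹ (h.right⁻¹ i)) (j := h.right⁻¹ i) rfl rfl).2]
    rfl

theorem ofSymmSemidirect_one : ofSymmSemidirect (1 : SymmSemidirect G n) = one := by
  refine IsThrough.ext ⟨fun _ => rfl, fun _ => rfl⟩ (fun i => ?_) fun i => ?_ <;> rfl

theorem not_isThrough_of_hasLeftEdge {x : GBrauerDiagram G n} {t : Fin n × Fin n × G}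
    (h : x.HasLeftEdge t) : ¬ x.IsThrough := fun hx => by
  have := hx.1 t.1
  rw [h.1] at this
  simp at this

/-- By counting, `IsThrough.left_iff` tests only the left column: right-to-right edges cannot occur
without left-to-left ones. So left edges alone generate the kernel. -/
theorem exists_hasLeftEdge {x : GBrauerDiagram G n} (h : ¬ x.IsThrough) :
    ∃ t, x.HasLeftEdge t := by
  rw [IsThrough.left_iff] at h
  push Not at h
  obtain ⟨i, hi⟩ := h
  rw [Ne, Sum.not_isRight, Sum.isLeft_iff] at hi
  obtain ⟨j, hj⟩ := hi
  exact ⟨(i, j, x.label (Sum.inl i)), hj, rfl⟩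

/-- A diagram with an odd number of left nodes has a left node joined to a right node. -/
theorem exists_left_to_right (hn : Odd n) (x : GBrauerDiagram G n) :
    ∃ c p, x.partner (Sum.inl c) = Sum.inr p := by
  by_contra! hc
  have hl : ∀ i, ∃ j, x.partner (Sum.inl i) = Sum.inl j := fun i => by
    rcases hx : x.partner (Sum.inl i) with j | p
    · exact ⟨j, rfl⟩
    · exact absurd hx (hc i p)
  choose f hf using hl
  -- Otherwise the partners form a fixed-point-free involution of the `n` left nodes; pairing the
  -- summands modulo `2` shows that `n` is even.
  have hsum : ∑ _i : Fin n, (1 : ZMod 2) = 0 :=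
    Finset.sum_involution (fun i _ => f i) (fun _ _ => by decide)
      (fun i _ _ e => x.partner_ne (Sum.inl i) (by rw [hf, e])) (fun _ _ => Finset.mem_univ _)
      fun i _ => Sum.inl_injective (β := Fin n) (by rw [← hf, ← hf, x.partner_partner])
  simp only [Finset.sum_const, Finset.card_univ, Fintype.card_fin, nsmul_eq_mul, mul_one] at hsum
  rw [ZMod.natCast_eq_zero_iff_even] at hsum
  exact (Nat.not_even_iff_odd.2 hn) hsum

/-- Absorbing one left edge of `x` keeps the other ones. -/
theorem hasLeftEdge_absorber_comp {x y : GBrauerDiagram G n} {a b c : Fin n} {g : G}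
    (hab : a ≠ b) (hac : a ≠ c) (hbc : b ≠ c) (hx : x.HasLeftEdge (a, b, g))
    {t : Fin n × Fin n × G} (ht : x.HasLeftEdge t) (hc : c ≠ t.1 ∧ c ≠ t.2.1)
    (hy : y.HasLeftEdge t) : (comp (absorber a b c g hab hac hbc) y).HasLeftEdge t := by
  obtain ⟨a', b', g'⟩ := t
  simp only [HasLeftEdge] at hx ht hc
  have hba : x.partner (Sum.inl b) = Sum.inl a := by rw [← hx.1, x.partner_partner]
  -- Two left edges of the same matching `x` coincide, up to orientation, or are disjoint. In the
  -- first case the absorber supplies the edge; in the second one it is straight at both ends of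
  -- `t`, since `c` is not an end either, and the edge is inherited from `y`.
  by_cases ha : a' = a
  · subst ha
    obtain rfl : b' = b := Sum.inl_injective (ht.1.symm.trans hx.1)
    obtain rfl : g' = g := ht.2.symm.trans hx.2
    exact HasLeftEdge.comp (by simp [HasLeftEdge, absorber]) y
  by_cases hb : a' = b
  · subst hb
    obtain rfl : b' = a := Sum.inl_injective (ht.1.symm.trans hba)
    obtain rfl : g' = g := by rw [← ht.2, ← hx.2, ← hx.1, x.label_partner]
    exact HasLeftEdge.comp (by simp [HasLeftEdge, absorber, ha]) y
  have hba' : x.partner (Sum.inl b') = Sum.inl a' := by rw [← ht.1, x.partner_partner]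
  have ha' : b' ≠ a := by
    rintro rfl
    exact hb (Sum.inl_injective (hba'.symm.trans hx.1))
  have hb' : b' ≠ b := by
    rintro rfl
    exact ha (Sum.inl_injective (hba'.symm.trans hba))
  exact hy.comp_left _ (by simp [absorber, ha, hb, hc.1.symm]) (by simp [absorber, ha, hb])
    (by simp [absorber, ha', hb', hc.2.symm]) (by simp [absorber, ha', hb'])

end Through

end GBrauerDiagram

/-! ### Left edge ideals and the projection onto the group algebra -/

namespace GBrauerAlgebra

open GBrauerDiagram

section DiagramIdeals

set_option linter.unusedSectionVars false

variable {G k : Type u} [CommGroup G] [CommRing k] [MulSemiringAction G k] {n : ℕ} {δ : k}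

/-- The linear combinations of the diagrams in `S`. -/
def diagramSpan (δ : k) (S : Set (GBrauerDiagram G n)) : Submodule k (GBrauerAlgebra G n δ) :=
  Finsupp.supported k k S

theorem ofDiagram_mem {S : Set (GBrauerDiagram G n)} {x : GBrauerDiagram G n} (hx : x ∈ S) :
    ofDiagram δ x ∈ diagramSpan δ S :=
  Finsupp.single_mem_supported k 1 hx

theorem diagramSpan_mono {S S' : Set (GBrauerDiagram G n)} (h : S ⊆ S') :
    diagramSpan δ S ≤ diagramSpan δ S' :=
  Finsupp.supported_mono h

theorem diagramSpan_univ : diagramSpan δ (Set.univ : Set (GBrauerDiagram G n)) = ⊤ :=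
  Finsupp.supported_univ

theorem diagramSpan_eq_span (S : Set (GBrauerDiagram G n)) :
    diagramSpan δ S = Submodule.span k (ofDiagram δ '' S) :=
  Finsupp.supported_eq_span_single k S

theorem diagramSpan_le {S : Set (GBrauerDiagram G n)} {N : Submodule k (GBrauerAlgebra G n δ)}
    (h : ∀ x ∈ S, ofDiagram δ x ∈ N) : diagramSpan δ S ≤ N := by
  rw [diagramSpan_eq_span, Submodule.span_le]
  rintro _ ⟨x, hx, rfl⟩
  exact h x hx

theorem eq_zero_of_mem_diagramSpan_empty {r : GBrauerAlgebra G n δ}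
    (h : r ∈ diagramSpan δ (∅ : Set (GBrauerDiagram G n))) : r = 0 := by
  exact (Submodule.mem_bot k).1 (Finsupp.supported_empty.le h)

theorem mul_mem_diagramSpan {S S' S'' : Set (GBrauerDiagram G n)}
    (h : ∀ x ∈ S, ∀ y ∈ S', comp x y ∈ S'') {a b : GBrauerAlgebra G n δ}
    (ha : a ∈ diagramSpan δ S) (hb : b ∈ diagramSpan δ S') : a * b ∈ diagramSpan δ S'' := by
  have h1 : ∀ x ∈ S, diagramSpan δ S' ≤
      (diagramSpan δ S'').comap (mulHom G n δ (ofDiagram δ x)) := fun x hx =>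
    diagramSpan_le fun y hy => by
      rw [Submodule.mem_comap, mulHom_ofDiagram]
      exact Submodule.smul_mem _ _ (ofDiagram_mem (h x hx y hy))
  have h2 : diagramSpan δ S ≤ (diagramSpan δ S'').comap ((mulHom G n δ).flip b) :=
    diagramSpan_le fun x hx => h1 x hx hb
  exact h2 ha

/-- The right ideal spanned by a set of diagrams that is closed under composition from the
right. -/
def diagramIdeal (δ : k) (S : Set (GBrauerDiagram G n)) (hS : ∀ x ∈ S, ∀ y, comp x y ∈ S) :
    Submodule (GBrauerAlgebra G n δ)ᵐᵒᵖ (GBrauerAlgebra G n δ) where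
  carrier := (diagramSpan δ S : Set (GBrauerAlgebra G n δ))
  add_mem' := Submodule.add_mem _
  zero_mem' := Submodule.zero_mem _
  smul_mem' a _ hr := mul_mem_diagramSpan (S' := Set.univ) (b := a.unop)
    (fun x hx y _ => hS x hx y) hr (by rw [diagramSpan_univ]; trivial)

theorem mem_diagramIdeal {S : Set (GBrauerDiagram G n)} {hS : ∀ x ∈ S, ∀ y, comp x y ∈ S}
    {r : GBrauerAlgebra G n δ} : r ∈ diagramIdeal δ S hS ↔ r ∈ diagramSpan δ S := Iff.rfl

/-- The diagrams that have all the left edges in `L`. -/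
def withLeftEdges (L : List (Fin n × Fin n × G)) : Set (GBrauerDiagram G n) :=
  {x | ∀ t ∈ L, x.HasLeftEdge t}

theorem comp_mem_withLeftEdges (L : List (Fin n × Fin n × G)) :
    ∀ x ∈ withLeftEdges L, ∀ y, comp x y ∈ withLeftEdges L :=
  fun _ hx y t ht => (hx t ht).comp y

theorem withLeftEdges_append (L L' : List (Fin n × Fin n × G)) :
    withLeftEdges (L ++ L') = withLeftEdges L ∩ withLeftEdges L' := by
  ext x
  simp only [withLeftEdges, List.mem_append, Set.mem_ofPred_eq, Set.mem_inter_iff]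
  grind

/-- The right ideal spanned by the diagrams that have all the left edges in `L`. -/
def leftEdgeIdeal (δ : k) (L : List (Fin n × Fin n × G)) :
    Submodule (GBrauerAlgebra G n δ)ᵐᵒᵖ (GBrauerAlgebra G n δ) :=
  diagramIdeal δ (withLeftEdges L) (comp_mem_withLeftEdges L)

theorem mem_leftEdgeIdeal {L : List (Fin n × Fin n × G)} {r : GBrauerAlgebra G n δ} :
    r ∈ leftEdgeIdeal δ L ↔ r ∈ diagramSpan δ (withLeftEdges L) := Iff.rfl

/-- Spans of subsets of a basis intersect in the span of the intersection. -/
theorem leftEdgeIdeal_append (L L' : List (Fin n × Fin n × G)) :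
    leftEdgeIdeal δ (L ++ L') = leftEdgeIdeal δ L ⊓ leftEdgeIdeal δ L' := by
  ext r
  rw [Submodule.mem_inf]
  simp only [leftEdgeIdeal, mem_diagramIdeal, diagramSpan, withLeftEdges_append,
    Finsupp.supported_inter]
  rfl

theorem absorber_mul {a b c : Fin n} {g : G} (hab : a ≠ b) (hac : a ≠ c) (hbc : b ≠ c)
    {r : GBrauerAlgebra G n δ} (hr : r ∈ diagramSpan δ {x | x.HasLeftEdge (a, b, g)}) :
    ofDiagram δ (absorber a b c g hab hac hbc) * r = r := by
  have h : diagramSpan δ {x | x.HasLeftEdge (a, b, g)} ≤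
      LinearMap.eqLocus (mulHom G n δ (ofDiagram δ (absorber a b c g hab hac hbc)))
        LinearMap.id := diagramSpan_le fun x hx => by
    rw [LinearMap.mem_eqLocus, mulHom_ofDiagram, (absorber_comp δ hab hac hbc hx).1,
      (absorber_comp δ hab hac hbc hx).2, one_smul, LinearMap.id_apply]
  exact h hr

/-- If `n` is odd, the right ideals `leftEdgeIdeal δ L` have left identities. -/
theorem exists_left_unit (hn : Odd n) (L : List (Fin n × Fin n × G)) :
    ∃ e ∈ leftEdgeIdeal δ L, ∀ r ∈ leftEdgeIdeal δ L, e * r = r := by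
  rcases (withLeftEdges L).eq_empty_or_nonempty with hL | ⟨x, hx⟩
  -- Incompatible edges occur in no diagram; the ideal is then zero and has `0` as a left identity.
  · refine ⟨0, Submodule.zero_mem _, fun r hr => ?_⟩
    rw [leftEdgeIdeal, mem_diagramIdeal, hL] at hr
    rw [eq_zero_of_mem_diagramSpan_empty hr, mul_zero]
  -- One diagram `x` and one spare node `c` serve all edges of `L` at once: `c` is joined to the
  -- right in `x`, so it is off every left edge of `x`.
  obtain ⟨c, p, hc⟩ := exists_left_to_right hn x
  have hcL : ∀ t, x.HasLeftEdge t → c ≠ t.1 ∧ c ≠ t.2.1 := by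
    rintro t ht
    constructor
    · rintro rfl
      exact Sum.inl_ne_inr (ht.1.symm.trans hc)
    · intro e
      have h := x.partner_partner (Sum.inl t.1)
      rw [ht.1, ← e, hc] at h
      exact Sum.inr_ne_inl h
  induction L with
  | nil =>
    refine ⟨1, ?_, fun r _ => one_mul r⟩
    have : withLeftEdges ([] : List (Fin n × Fin n × G)) = Set.univ := by
      simp [withLeftEdges]
    rw [leftEdgeIdeal, mem_diagramIdeal, this, diagramSpan_univ]
    trivial
  | cons s L ih =>
    obtain ⟨a, b, g⟩ := s
    have hs : x.HasLeftEdge (a, b, g) := hx _ (by simp)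
    have hab : a ≠ b := fun e => x.partner_ne (Sum.inl a) (by rw [hs.1, e])
    obtain ⟨hca, hcb⟩ := hcL _ hs
    have hxL : x ∈ withLeftEdges L := fun t ht => hx t (List.mem_cons_of_mem _ ht)
    obtain ⟨e, he, her⟩ := ih hxL
    -- The identity for the tail fixes `r` first, then the absorber does, as `r` involves only
    -- diagrams with the edge `(a, b, g)`. The product lies in the smaller ideal because the
    -- absorber adds this edge and preserves those of the tail.
    refine ⟨ofDiagram δ (absorber a b c g hab hca.symm hcb.symm) * e, ?_, fun r hr => ?_⟩
    · refine mul_mem_diagramSpan (S := {absorber a b c g hab hca.symm hcb.symm}) ?_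
        (ofDiagram_mem rfl) (mem_leftEdgeIdeal.1 he)
      rintro _ rfl y hy t ht
      rcases List.mem_cons.1 ht with rfl | htL
      · exact HasLeftEdge.comp (by simp [HasLeftEdge, absorber]) y
      · exact hasLeftEdge_absorber_comp hab _ _ hs (hxL t htL) (hcL t (hxL t htL)) (hy t htL)
    · have h1 : r ∈ diagramSpan δ {x | x.HasLeftEdge (a, b, g)} :=
        diagramSpan_mono (fun y hy => (show y ∈ withLeftEdges _ from hy) _ (by simp)) hr
      have h2 : r ∈ leftEdgeIdeal δ L :=
        diagramSpan_mono (fun y hy t ht =>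
          (show y ∈ withLeftEdges _ from hy) t (List.mem_cons_of_mem _ ht)) hr
      rw [mul_assoc, her r h2, absorber_mul hab _ _ h1]

/-- Scalars of `k` are central in the algebra, so a right ideal is also a `k`-submodule and may be
tested on diagrams. -/
theorem mem_of_mem_diagramSpan
    {N : Submodule (GBrauerAlgebra G n δ)ᵐᵒᵖ (GBrauerAlgebra G n δ)}
    {S : Set (GBrauerDiagram G n)} (h : ∀ x ∈ S, ofDiagram δ x ∈ N)
    {r : GBrauerAlgebra G n δ} (hr : r ∈ diagramSpan δ S) : r ∈ N := by
  rw [diagramSpan_eq_span] at hr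
  induction hr using Submodule.span_induction with
  | mem r hr =>
    obtain ⟨x, hx, rfl⟩ := hr
    exact h x hx
  | zero => exact N.zero_mem
  | add r r' _ _ h h' => exact N.add_mem h h'
  | smul c r _ h =>
    rw [Algebra.smul_def, Algebra.commutes]
    exact N.smul_mem (MulOpposite.op (algebraMap k _ c)) h

theorem mem_listSup_of_mem_diagramSpan {ι : Type*} (E : ι → List (Fin n × Fin n × G)) (l : List ι)
    {S : Set (GBrauerDiagram G n)} (h : ∀ x ∈ S, ∃ i ∈ l, x ∈ withLeftEdges (E i))
    {r : GBrauerAlgebra G n δ} (hr : r ∈ diagramSpan δ S) :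
    r ∈ listSup (fun i => leftEdgeIdeal δ (E i)) l :=
  mem_of_mem_diagramSpan (fun x hx => by
    obtain ⟨i, hi, hxi⟩ := h x hx
    exact le_listSup (fun i => leftEdgeIdeal δ (E i)) hi
      (mem_leftEdgeIdeal.2 (ofDiagram_mem hxi))) hr

/-- All ideals involved are spanned by sets of diagrams, so sums and intersections correspond to
unions and intersections of these sets, where distributivity is clear. -/
theorem listSup_inf_leftEdgeIdeal_le {ι : Type*} (E : ι → List (Fin n × Fin n × G))
    (inter : ι → ι → ι) (hinter : ∀ i j, E (inter i j) = E i ++ E j) (l : List ι) (j : ι) :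
    listSup (fun i => leftEdgeIdeal δ (E i)) l ⊓ leftEdgeIdeal δ (E j) ≤
      listSup (fun i => leftEdgeIdeal δ (E i)) (l.map fun i => inter i j) := by
  set S := {x : GBrauerDiagram G n | ∃ i ∈ l, x ∈ withLeftEdges (E i)} with hS
  have h1 : listSup (fun i => leftEdgeIdeal δ (E i)) l ≤ diagramIdeal δ S
      (by
        rintro x ⟨i, hi, hx⟩ y
        exact ⟨i, hi, comp_mem_withLeftEdges _ x hx y⟩) :=
    listSup_le _ fun i hi r hr =>
      diagramSpan_mono (show withLeftEdges (E i) ⊆ S from fun x hx => ⟨i, hi, hx⟩) hr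
  rintro r ⟨hr, hr'⟩
  have h2 : r ∈ diagramSpan δ (S ∩ withLeftEdges (E j)) := by
    rw [diagramSpan, Finsupp.supported_inter]
    exact ⟨h1 hr, hr'⟩
  refine mem_listSup_of_mem_diagramSpan E _ ?_ h2
  rintro x ⟨⟨i, hi, hx⟩, hx'⟩
  refine ⟨inter i j, List.mem_map_of_mem hi, ?_⟩
  rw [hinter, withLeftEdges_append]
  exact ⟨hx, hx'⟩

open Classical in
/-- The linear map underlying `toGroupAlgebra`. -/
noncomputable def toGroupAlgebraLinear (G : Type u) [CommGroup G] (n : ℕ) (δ : k) :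
    GBrauerAlgebra G n δ →ₗ[k] MonoidAlgebra k (SymmSemidirect G n) :=
  Finsupp.linearCombination k fun x : GBrauerDiagram G n =>
    if hx : x.IsThrough then MonoidAlgebra.single hx.exists_eq.choose (1 : k) else 0

open Classical in
theorem toGroupAlgebraLinear_ofDiagram (x : GBrauerDiagram G n) :
    toGroupAlgebraLinear G n δ (ofDiagram δ x) =
      if hx : x.IsThrough then MonoidAlgebra.single hx.exists_eq.choose (1 : k) else 0 :=
  (Finsupp.linearCombination_single ..).trans (one_smul ..)

theorem toGroupAlgebraLinear_ofSymmSemidirect (h : SymmSemidirect G n) :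
    toGroupAlgebraLinear G n δ (ofDiagram δ (ofSymmSemidirect h)) =
      MonoidAlgebra.single h (1 : k) := by
  have hx := isThrough_ofSymmSemidirect h
  rw [toGroupAlgebraLinear_ofDiagram, dif_pos hx,
    ofSymmSemidirect_injective hx.exists_eq.choose_spec]

theorem toGroupAlgebraLinear_of_not_isThrough {x : GBrauerDiagram G n} (hx : ¬ x.IsThrough) :
    toGroupAlgebraLinear G n δ (ofDiagram δ x) = 0 := by
  rw [toGroupAlgebraLinear_ofDiagram, dif_neg hx]

/-- On two through diagrams no loops arise and this is `ofSymmSemidirect_mul`. If one factor is not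
through, neither is the composite, by `IsThrough.of_comp`, and both sides vanish whatever the
weight. -/
theorem toGroupAlgebraLinear_mul (a b : GBrauerAlgebra G n δ) :
    toGroupAlgebraLinear G n δ (a * b) =
      toGroupAlgebraLinear G n δ a * toGroupAlgebraLinear G n δ b := by
  suffices h : toGroupAlgebraLinear G n δ ∘ₗ (mulHom G n δ).flip b =
      (LinearMap.mul k _).flip (toGroupAlgebraLinear G n δ b) ∘ₗ toGroupAlgebraLinear G n δ from
    LinearMap.congr_fun h a
  refine hom_ext fun x => ?_
  suffices h : toGroupAlgebraLinear G n δ ∘ₗ mulHom G n δ (ofDiagram δ x) =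
      (LinearMap.mul k _ (toGroupAlgebraLinear G n δ (ofDiagram δ x))) ∘ₗ
        toGroupAlgebraLinear G n δ from
    LinearMap.congr_fun h b
  refine hom_ext fun y => ?_
  simp only [LinearMap.comp_apply, mulHom_ofDiagram, map_smul, LinearMap.mul_apply']
  by_cases hx : x.IsThrough
  · by_cases hy : y.IsThrough
    · rw [(GBrauerDiagram.IsThrough.comp δ hx hy).2, one_smul]
      obtain ⟨g, rfl⟩ := hx.exists_eq
      obtain ⟨h, rfl⟩ := hy.exists_eq
      rw [ofSymmSemidirect_mul]
      simp only [toGroupAlgebraLinear_ofSymmSemidirect, MonoidAlgebra.single_mul_single, mul_one]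
    · rw [toGroupAlgebraLinear_of_not_isThrough hy, mul_zero,
        toGroupAlgebraLinear_of_not_isThrough fun h => hy (IsThrough.of_comp h).2, smul_zero]
  · rw [toGroupAlgebraLinear_of_not_isThrough hx, zero_mul,
      toGroupAlgebraLinear_of_not_isThrough fun h => hx (IsThrough.of_comp h).1, smul_zero]

/-- The surjection of the `G`-Brauer algebra onto the group algebra of `G^n ⋊ Σ_n` that kills the
diagrams with left-to-left or right-to-right connections. -/
noncomputable def toGroupAlgebra (G : Type u) [CommGroup G] [MulSemiringAction G k] (n : ℕ)
    (δ : k) : GBrauerAlgebra G n δ →ₐ[k] MonoidAlgebra k (SymmSemidirect G n) :=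
  AlgHom.ofLinearMap (toGroupAlgebraLinear G n δ)
    (by
      rw [one_def, ← ofSymmSemidirect_one, toGroupAlgebraLinear_ofSymmSemidirect]
      rfl)
    toGroupAlgebraLinear_mul

theorem toGroupAlgebra_apply (a : GBrauerAlgebra G n δ) :
    toGroupAlgebra G n δ a = toGroupAlgebraLinear G n δ a := rfl

/-- The inclusion of the group algebra of `G^n ⋊ Σ_n` into the `G`-Brauer algebra. -/
noncomputable def ofGroupAlgebra (G : Type u) [CommGroup G] [MulSemiringAction G k] (n : ℕ)
    (δ : k) : MonoidAlgebra k (SymmSemidirect G n) →ₐ[k] GBrauerAlgebra G n δ :=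
  MonoidAlgebra.lift k _ (SymmSemidirect G n)
    { toFun := fun h => ofDiagram δ (ofSymmSemidirect h)
      map_one' := by rw [ofSymmSemidirect_one, one_def]
      map_mul' := fun g h => by
        rw [ofDiagram_mul, ofSymmSemidirect_mul, (GBrauerDiagram.IsThrough.comp δ
          (isThrough_ofSymmSemidirect g) (isThrough_ofSymmSemidirect h)).2, one_smul] }

theorem ofGroupAlgebra_single (h : SymmSemidirect G n) :
    ofGroupAlgebra G n δ (MonoidAlgebra.single h 1) = ofDiagram δ (ofSymmSemidirect h) := by
  simp [ofGroupAlgebra]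

theorem toGroupAlgebra_ofGroupAlgebra (b : MonoidAlgebra k (SymmSemidirect G n)) :
    toGroupAlgebra G n δ (ofGroupAlgebra G n δ b) = b := by
  have h : (toGroupAlgebra G n δ).comp (ofGroupAlgebra G n δ) = AlgHom.id k _ :=
    MonoidAlgebra.algHom_ext (fun h => by
      rw [AlgHom.comp_apply, ofGroupAlgebra_single, toGroupAlgebra_apply,
        toGroupAlgebraLinear_ofSymmSemidirect]
      rfl) (by ext)
  exact DFunLike.congr_fun h b

theorem groupAugmentation_toGroupAlgebra (a : GBrauerAlgebra G n δ) :
    groupAugmentation k (SymmSemidirect G n) (toGroupAlgebra G n δ a) =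
      augmentation G n δ a := by
  have h : (groupAugmentation k (SymmSemidirect G n)).toLinearMap ∘ₗ toGroupAlgebraLinear G n δ =
      augmentationLinear G n δ := hom_ext fun x => by
    rw [LinearMap.comp_apply, augmentationLinear_ofDiagram]
    by_cases hx : x.IsThrough
    · rw [if_pos hx]
      obtain ⟨g, rfl⟩ := hx.exists_eq
      rw [toGroupAlgebraLinear_ofSymmSemidirect, AlgHom.toLinearMap_apply, groupAugmentation_single]
    · rw [if_neg hx, toGroupAlgebraLinear_of_not_isThrough hx, map_zero]
  exact LinearMap.congr_fun h a

/-- Diagrams are either through or not, so the algebra splits as the image of the group algebra plus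
the span of the others. In particular the kernel of `toGroupAlgebra` consists of combinations of
non-through diagrams. -/
theorem sub_ofGroupAlgebra_mem (a : GBrauerAlgebra G n δ) :
    a - ofGroupAlgebra G n δ (toGroupAlgebra G n δ a) ∈ diagramSpan δ {x | ¬ x.IsThrough} := by
  have h : (⊤ : Submodule k (GBrauerAlgebra G n δ)) ≤ (diagramSpan δ {x | ¬ x.IsThrough}).comap
      (LinearMap.id - (ofGroupAlgebra G n δ).toLinearMap ∘ₗ toGroupAlgebraLinear G n δ) := by
    rw [← diagramSpan_univ]
    refine diagramSpan_le fun x _ => ?_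
    rw [Submodule.mem_comap, LinearMap.sub_apply, LinearMap.comp_apply, LinearMap.id_apply,
      AlgHom.toLinearMap_apply]
    by_cases hx : x.IsThrough
    · obtain ⟨g, rfl⟩ := hx.exists_eq
      rw [toGroupAlgebraLinear_ofSymmSemidirect, ofGroupAlgebra_single, sub_self]
      exact Submodule.zero_mem _
    · rw [toGroupAlgebraLinear_of_not_isThrough hx, map_zero, sub_zero]
      exact ofDiagram_mem hx
  exact h (x := a) trivial

theorem toGroupAlgebra_eq_zero {L : List (Fin n × Fin n × G)} (hL : L ≠ [])
    {r : GBrauerAlgebra G n δ} (hr : r ∈ leftEdgeIdeal δ L) : toGroupAlgebra G n δ r = 0 := by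
  have h : diagramSpan δ (withLeftEdges L) ≤ LinearMap.ker (toGroupAlgebraLinear G n δ) :=
    diagramSpan_le fun x hx => by
      obtain ⟨t, ht⟩ := List.exists_mem_of_ne_nil L hL
      exact toGroupAlgebraLinear_of_not_isThrough (not_isThrough_of_hasLeftEdge (hx t ht))
  exact h (mem_leftEdgeIdeal.1 hr)

-- A kernel element involves finitely many diagrams, none of them through. Choosing one left edge
-- from each gives finitely many one-element lists `L` that suffice.
open Classical in
theorem exists_mem_listSup_leftEdgeIdeal {r : GBrauerAlgebra G n δ}
    (hr : toGroupAlgebra G n δ r = 0) :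
    ∃ l, r ∈ listSup (fun L : {L : List (Fin n × Fin n × G) // L ≠ []} => leftEdgeIdeal δ L.1)
      l := by
  have h := sub_ofGroupAlgebra_mem r
  rw [hr, map_zero, sub_zero] at h
  have hS : ∀ s : Finset (GBrauerDiagram G n), (∀ x ∈ s, ¬ x.IsThrough) →
      ∃ l : List {L : List (Fin n × Fin n × G) // L ≠ []},
        ∀ x ∈ s, ∃ L ∈ l, x ∈ withLeftEdges L.1 := by
    intro s
    induction s using Finset.induction with
    | empty => exact fun _ => ⟨[], by simp⟩
    | insert x s _ ih =>
      intro hs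
      obtain ⟨l, hl⟩ := ih fun y hy => hs y (Finset.mem_insert_of_mem hy)
      obtain ⟨t, ht⟩ := exists_hasLeftEdge (hs x (Finset.mem_insert_self x s))
      refine ⟨⟨[t], List.cons_ne_nil _ _⟩ :: l, fun y hy => ?_⟩
      rcases Finset.mem_insert.1 hy with rfl | hy
      · exact ⟨_, List.mem_cons_self, by simpa [withLeftEdges] using ht⟩
      · obtain ⟨L, hL, hyL⟩ := hl y hy
        exact ⟨L, List.mem_cons_of_mem _ hL, hyL⟩
  obtain ⟨l, hl⟩ := hS (Finsupp.support (M := k) r) fun x hx => h hx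
  exact ⟨l, mem_listSup_of_mem_diagramSpan (S := (Finsupp.support (M := k) r : Set _))
    (fun L => L.1) l hl ((Finsupp.mem_supported k _).2 subset_rfl)⟩

end DiagramIdeals

end GBrauerAlgebra

/-! ### The two isomorphisms -/

-- The ideals are indexed by nonempty lists, since the empty list would give the whole algebra and
-- not a part of the kernel; intersection of ideals is concatenation of lists.
open GBrauerAlgebra in
theorem nonempty_trivialTor_gBrauerAlgebra_equiv {G k : Type u} [CommGroup G] [CommRing k]
    [MulSemiringAction G k] {n : ℕ} (hn : Odd n) (δ : k) :
    Nonempty (∀ q : ℕ, trivialTor (GBrauerAlgebra.augmentation G n δ) q ≃ₗ[k]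
        trivialTor (groupAugmentation k (SymmSemidirect G n)) q) := by
  refine nonempty_trivialTor_equiv (toGroupAlgebra G n δ).toRingHom
    (fun L : {L : List (Fin n × Fin n × G) // L ≠ []} => leftEdgeIdeal δ L.1)
    (ofGroupAlgebra G n δ).toRingHom _ _ ?_ ?_
    (fun L L' => ⟨L.1 ++ L'.1, fun h => L.2 (List.append_eq_nil_iff.1 h).1⟩)
    ?_ ?_ ?_ ?_ ?_
  · exact toGroupAlgebra_ofGroupAlgebra
  · exact groupAugmentation_toGroupAlgebra
  · exact fun L L' => leftEdgeIdeal_append L.1 L'.1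
  · intro l L
    exact listSup_inf_leftEdgeIdeal_le (fun L : {L : List (Fin n × Fin n × G) // L ≠ []} => L.1)
      (fun L L' => ⟨L.1 ++ L'.1, fun h => L.2 (List.append_eq_nil_iff.1 h).1⟩)
      (fun L L' => rfl) l L
  · exact fun L => exists_left_unit hn L.1
  · exact fun L r hr => toGroupAlgebra_eq_zero L.2 hr
  · exact fun r hr => exists_mem_listSup_leftEdgeIdeal hr

theorem mainTheorem8 {G k : Type u} [CommGroup G] [CommRing k] [MulSemiringAction G k]
    (n : ℕ) (hn : Odd n) (δ : k) :
    Nonempty (∀ q : ℕ, trivialTor (GBrauerAlgebra.augmentation G n δ) q ≃ₗ[k]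
        trivialTor (groupAugmentation k (SymmSemidirect G n)) q) ∧
      Nonempty (∀ q : ℕ, trivialTor (groupAugmentation k (SymmSemidirect G n)) q ≃ₗ[k]
        groupHomology (Rep.trivial k (SymmSemidirect G n) k) q) :=
  ⟨nonempty_trivialTor_gBrauerAlgebra_equiv hn δ,
    -- This half holds for every group and uses neither the Brauer algebra nor the parity of `n`.
    ⟨fun q => (trivialTorIsoGroupHomology k _ q).toLinearEquiv⟩⟩
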